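/- All graphs are finite and simple. A proper edge-coloring of a graph gives distinct colors to any two edges that share an endpoint (any number of colors may be used), and a subgraph is rainbow if its edges have pairwise distinct colors. Let $\mathrm{ex}^*_{\mathcal P}(n, C_4)$ be the maximum number of edges in an $n$-vertex planar graph that has a proper edge-coloring with no rainbow copy of the 4-cycle $C_4$. For every integer $k \ge 5$ and $n = k^2 - 3k + 2$, $$\mathrm{ex}^*_{\mathcal P}(n, C_4) = 3n - 6.$$ -/

import Mathlib

namespace SimpleGraph

/-- A drawing of a graph in the Euclidean plane without crossings: vertices are distinct points,
every edge is a simple arc joining its two ends, no arc passes through a vertex other than its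
ends, and two distinct arcs meet at most in vertices (hence only in common ends). -/
structure PlaneEmbedding {V : Type*} (G : SimpleGraph V) where
  /-- The point that represents a vertex. -/
  point : V → ℝ × ℝ
  /-- The arc that represents an edge, with an arbitrary direction of traversal. -/
  arc : G.edgeSet → unitInterval → ℝ × ℝ
  point_injective : Function.Injective point
  arc_continuous : ∀ e, Continuous (arc e)
  arc_injective : ∀ e, Function.Injective (arc e)
  arc_ends : ∀ e : G.edgeSet, {arc e 0, arc e 1} = point '' {v | v ∈ (e : Sym2 V)}
  mem_of_point_mem_arc : ∀ (e : G.edgeSet) (v : V),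
    point v ∈ Set.range (arc e) → v ∈ (e : Sym2 V)
  arc_inter_subset : ∀ e f : G.edgeSet, e ≠ f →
    Set.range (arc e) ∩ Set.range (arc f) ⊆ Set.range point

/-- A graph is planar if it can be drawn in the plane without crossings. -/
def IsPlanar {V : Type*} (G : SimpleGraph V) : Prop :=
  Nonempty G.PlaneEmbedding

/-- A proper edge-coloring with colors in `K`: edges that share an end receive distinct colors.
This is a proper vertex-coloring of the line graph. -/
abbrev ProperEdgeColoring {V : Type*} (G : SimpleGraph V) (K : Type*) : Type _ :=
  G.lineGraph.Coloring K

/-- A copy of `H` in `G` (not necessarily induced) is rainbow if its edges receive pairwise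
distinct colors. -/
def ProperEdgeColoring.IsRainbow {V W K : Type*} {G : SimpleGraph V} {H : SimpleGraph W}
    (c : G.ProperEdgeColoring K) (f : Copy H G) : Prop :=
  Function.Injective fun e : H.edgeSet => c (f.mapEdgeSet e)

/-- `G` has a proper edge-coloring (with any number of colors) and no rainbow copy of `H`.
As graphs here are finite, colors in `ℕ` are no restriction. -/
def HasRainbowFreeColoring {V W : Type*} (G : SimpleGraph V) (H : SimpleGraph W) : Prop :=
  ∃ c : G.ProperEdgeColoring ℕ, ∀ f : Copy H G, ¬ c.IsRainbow f

open scoped Classical in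
/-- The rainbow planar Turán number: the maximum number of edges in an `n`-vertex planar graph
that has a proper edge-coloring with no rainbow copy of `H`. -/
noncomputable def rainbowPlanarTuranNumber (n : ℕ) {W : Type*} (H : SimpleGraph W) : ℕ :=
  Finset.sup {G : SimpleGraph (Fin n) | G.IsPlanar ∧ G.HasRainbowFreeColoring H}
    fun G => G.edgeFinset.card

end SimpleGraph

open scoped unitInterval

namespace SimpleGraph

/-! ### Change of the logarithm along a curve -/

/-! The upper bound ignores colors: it is the edge bound for planar graphs. Instead of Euler's
formula, the proof weakens planarity to `HasIndependentDrawing`, where arcs need not be simple and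
only edges without a common end must be disjoint. This property passes to contractions without any
redrawing, and K₅ lacks it by a parity count of winding numbers (`not_hasIndependentDrawing_top`).
In a minimal counterexample to the bound every edge lies in at least three triangles and some vertex
has degree 4 or 5; its neighborhood is then so dense that K₅ appears, if need be after one
contraction.

For the lower bound, wrap the triangular lattice around a cylinder of circumference k and collapse
the two ends to poles. Away from the poles a 4-cycle lifts to the lattice because k ≥ 5, and there
it bounds a rhombus spanned by two of the three directions. Horizontal colors are constant along the
vertical direction, vertical colors along the diagonal one, diagonal colors along the horizontal
one, so every rhombus has two opposite edges of one color (`stepColor_rhombus`). Horizontal and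
vertical edges draw on the same palette `ZMod k`, which settles the 4-cycles through a pole
(`exists_opposite_color_of_pole`). The coloring stays proper because the rows of the rings avoid 0,
-1 and -2 modulo k.

For planarity, edges are straight segments on the cylinder; the cylinder with collapsed ends is the
Riemann sphere, and a point off all edges is sent to infinity. -/

theorem exists_continuous_log {F : I × I → ℂ} (hF : Continuous F) (h0 : ∀ x, F x ≠ 0) :
    ∃ L : I × I → ℂ, Continuous L ∧ ∀ x, Complex.exp (L x) = F x := by
  -- Clamping both coordinates extends `F` to the whole plane, which is simply connected, so the
  -- extension lifts through the covering `exp`.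
  let F' : C(ℝ × ℝ, ℂ) :=
    ⟨fun x => F (Set.projIcc 0 1 zero_le_one x.1, Set.projIcc 0 1 zero_le_one x.2),
      hF.comp ((continuous_projIcc.comp continuous_fst).prodMk
        (continuous_projIcc.comp continuous_snd))⟩
  obtain ⟨L, ⟨-, hL⟩, -⟩ := Complex.isCoveringMapOn_exp.existsUnique_continuousMap_lifts
    (f := F') (a₀ := (0 : ℝ × ℝ)) (e₀ := Complex.log (F' 0))
    (Complex.exp_log (h0 _)) (fun x => by exact h0 _)
  refine ⟨fun x => L (x.1, x.2), by fun_prop, fun x => ?_⟩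
  have := congr_fun hL ((x.1 : ℝ), (x.2 : ℝ))
  simpa [F'] using this

theorem log_lift_sub_eq {f g : I → ℂ} (hf : Continuous f) (hg : Continuous g)
    (h : ∀ t, Complex.exp (f t) = Complex.exp (g t)) : f 1 - f 0 = g 1 - g 0 := by
  have key : f = fun t => g t + (f 0 - g 0) := by
    refine Complex.isCoveringMap_exp.eq_of_comp_eq hf (by fun_prop) ?_ 0 (by ring)
    funext t
    simp [Complex.exp_add, Complex.exp_sub, h]
  have := congr_fun key 1
  rw [this]; ring

open Classical in
/-- The increment along `f` of a continuous logarithm of `f`, if there is one. -/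
noncomputable def logChange (f : I → ℂ) : ℂ :=
  if h : ∃ L : I → ℂ, Continuous L ∧ ∀ t, Complex.exp (L t) = f t then h.choose 1 - h.choose 0
  else 0

theorem logChange_eq {f L : I → ℂ} (hL : Continuous L) (h : ∀ t, Complex.exp (L t) = f t) :
    logChange f = L 1 - L 0 := by
  have hex : ∃ L : I → ℂ, Continuous L ∧ ∀ t, Complex.exp (L t) = f t := ⟨L, hL, h⟩
  rw [logChange, dif_pos hex]
  exact log_lift_sub_eq hex.choose_spec.1 hL fun t => by rw [hex.choose_spec.2, h]

theorem logChange_neg_eq {f L : I → ℂ} (hL : Continuous L) (h : ∀ t, Complex.exp (L t) = - f t) :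
    logChange f = L 1 - L 0 := by
  rw [logChange_eq (L := fun t => L t + Real.pi * Complex.I) (by fun_prop)]
  · ring
  · intro t
    rw [Complex.exp_add, h, Complex.exp_pi_mul_I]; ring

theorem exp_logChange {f : I → ℂ} (hf : Continuous f) (h0 : ∀ t, f t ≠ 0) :
    Complex.exp (logChange f) = f 1 / f 0 := by
  obtain ⟨L, hL, h⟩ := exists_continuous_log (F := fun x => f x.1) (by fun_prop) fun x => h0 _
  rw [logChange_eq (L := fun t => L (t, 0)) (by fun_prop) fun t => h _, Complex.exp_sub, h, h]

/-- For two disjoint paths, the logarithm of the difference has no monodromy around the boundary of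
the parameter square. -/
theorem logChange_square {a b c d : ℂ} (α : _root_.Path a b) (β : _root_.Path c d) (h : ∀ s t, α s ≠ β t) :
    logChange (fun s => α s - c) + logChange (fun t => β t - b) =
      logChange (fun t => β t - a) + logChange (fun s => α s - d) := by
  obtain ⟨L, hL, hexp⟩ := exists_continuous_log (F := fun x => α x.1 - β x.2) (by fun_prop)
    fun x => sub_ne_zero.2 (h _ _)
  have h1 : logChange (fun s => α s - c) = L (1, 0) - L (0, 0) :=
    logChange_eq (L := fun s => L (s, 0)) (by fun_prop) fun s => by simp [hexp]
  have h2 : logChange (fun t => β t - b) = L (1, 1) - L (1, 0) :=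
    logChange_neg_eq (L := fun t => L (1, t)) (by fun_prop) fun s => by simp [hexp]
  have h3 : logChange (fun t => β t - a) = L (0, 1) - L (0, 0) :=
    logChange_neg_eq (L := fun t => L (0, t)) (by fun_prop) fun s => by simp [hexp]
  have h4 : logChange (fun s => α s - d) = L (1, 1) - L (0, 1) :=
    logChange_eq (L := fun s => L (s, 1)) (by fun_prop) fun s => by simp [hexp]
  rw [h1, h2, h3, h4]
  ring

/-! ### Drawings in which independent edges do not meet -/

/-- A drawing of a graph in the plane in which edges without a common end do not meet. -/
def HasIndependentDrawing {V : Type*} (G : SimpleGraph V) : Prop :=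
  ∃ (p : V → ℂ) (γ : ∀ a b, _root_.Path (p a) (p b)), ∀ a b c d, G.Adj a b → G.Adj c d →
    a ≠ c → a ≠ d → b ≠ c → b ≠ d → ∀ s t, γ a b s ≠ γ c d t

/-- Principal logarithms are used for a < b and shifted by πi in the other order. Exchanging the two
points then costs exactly ±πi with a known sign, which leaves only integers in the parity count for
K₅. -/
theorem exists_antisymm_log {p : Fin 5 → ℂ} (hp : Function.Injective p) :
    ∃ l : Fin 5 → Fin 5 → ℂ, (∀ a b, a ≠ b → Complex.exp (l a b) = p a - p b) ∧
      ∀ a b, a ≠ b → l a b - l b a = ((if a < b then -1 else 1 : ℤ) : ℂ) * (Real.pi * Complex.I) := by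
  refine ⟨fun a b => if a < b then Complex.log (p a - p b)
    else Complex.log (p b - p a) + Real.pi * Complex.I, fun a b hab => ?_, fun a b hab => ?_⟩
  · dsimp only
    split_ifs with h
    · exact Complex.exp_log (sub_ne_zero.2 (hp.ne hab))
    · rw [Complex.exp_add, Complex.exp_log (sub_ne_zero.2 (hp.ne hab.symm)), Complex.exp_pi_mul_I]
      ring
  · dsimp only
    rcases lt_or_gt_of_ne hab with h | h
    · simp [h, h.not_gt]
    · simp [h, h.not_gt]

/-- Up to the chosen logarithms, the winding of the arc ij around the point k is an integer `N k i
j`. For two disjoint edges `logChange_square` turns into a linear relation between four of these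
integers and four signs. The fifteen relations together are contradictory modulo 4. -/
theorem not_hasIndependentDrawing_top : ¬ (⊤ : SimpleGraph (Fin 5)).HasIndependentDrawing := by
  rintro ⟨p, γ, hγ⟩
  replace hγ : ∀ a b c d, a ≠ b → c ≠ d → a ≠ c → a ≠ d → b ≠ c → b ≠ d →
      ∀ s t, γ a b s ≠ γ c d t := fun a b c d hab hcd => hγ a b c d hab hcd
  have havoid : ∀ i j k, i ≠ j → i ≠ k → j ≠ k → ∀ t, γ i j t - p k ≠ 0 := by
    intro i j k hij hik hjk t
    -- The arc from k to a further vertex l starts at `p k` and is disjoint from the arc ij.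
    obtain ⟨l, hl⟩ : ∃ l : Fin 5, l ≠ i ∧ l ≠ j ∧ l ≠ k := by
      revert i j k; decide
    have := hγ i j k l hij hl.2.2.symm hik hl.1.symm hjk hl.2.1.symm t 0
    rw [sub_ne_zero]
    simpa using this
  have hp : Function.Injective p := by
    intro a b hab
    by_contra hne
    obtain ⟨c, hc⟩ : ∃ c : Fin 5, c ≠ a ∧ c ≠ b := by clear hab hne; revert a b; decide
    apply havoid a c b hc.1.symm hne hc.2 0
    simp [hab]
  obtain ⟨l, hl, hanti⟩ := exists_antisymm_log hp
  have hN : ∀ k i j, ∃ n : ℤ, i ≠ j → i ≠ k → j ≠ k →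
      logChange (fun s => γ i j s - p k) = l j k - l i k + n * (2 * Real.pi * Complex.I) := by
    intro k i j
    by_cases h : i ≠ j ∧ i ≠ k ∧ j ≠ k
    · obtain ⟨hij, hik, hjk⟩ := h
      obtain ⟨n, hn⟩ := Complex.exp_eq_exp_iff_exists_int.1
        (show Complex.exp (logChange (fun s => γ i j s - p k)) = Complex.exp (l j k - l i k) by
          rw [exp_logChange (by fun_prop) (havoid i j k hij hik hjk), Complex.exp_sub, hl _ _ hjk,
            hl _ _ hik]
          simp)
      exact ⟨n, fun _ _ _ => hn⟩
    · exact ⟨0, fun h1 h2 h3 => absurd ⟨h1, h2, h3⟩ h⟩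
  choose N hN using hN
  have key : ∀ i j k m : Fin 5, (i ≠ j ∧ k ≠ m ∧ i ≠ k ∧ i ≠ m ∧ j ≠ k ∧ j ≠ m) →
      (if j < k then -1 else 1 : ℤ) + (if m < j then -1 else 1) + (if k < i then -1 else 1) +
        (if i < m then -1 else 1) + 2 * (N k i j + N j k m - N i k m - N m i j) = 0 := by
    rintro i j k m ⟨hij, hkm, hik, him, hjk, hjm⟩
    have hsq := logChange_square (γ i j) (γ k m) (hγ i j k m hij hkm hik him hjk hjm)
    rw [hN k i j hij hik hjk, hN j k m hkm hjk.symm hjm.symm, hN i k m hkm hik.symm him.symm,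
      hN m i j hij him hjm] at hsq
    have h1 := hanti j k hjk
    have h2 := hanti m j hjm.symm
    have h3 := hanti k i hik.symm
    have h4 := hanti i m him
    have hpi : (Real.pi * Complex.I : ℂ) ≠ 0 := by simp [Real.pi_ne_zero]
    have hc : (((if j < k then -1 else 1 : ℤ) + (if m < j then -1 else 1) +
        (if k < i then -1 else 1) + (if i < m then -1 else 1) +
        2 * (N k i j + N j k m - N i k m - N m i j) : ℤ) : ℂ) * (Real.pi * Complex.I) = 0 := by
      push_cast at h1 h2 h3 h4 ⊢
      linear_combination hsq - h1 - h2 - h3 - h4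
    exact_mod_cast (mul_eq_zero.1 hc).resolve_right hpi
  -- All pairs of disjoint edges, each edge written in increasing order. The four signs add up to 2
  -- if the pairs interleave and to 0 otherwise; each of the five 4-sets has one interleaving pair,
  -- so the signs total 10. Each `N k i j` occurs in two relations, once for each choice of the
  -- fourth vertex, so the terms `2 * N` contribute a multiple of 4.
  have e1 := key 0 1 2 3 (by decide)
  have e2 := key 0 2 1 3 (by decide)
  have e3 := key 0 3 1 2 (by decide)
  have e4 := key 0 1 2 4 (by decide)
  have e5 := key 0 2 1 4 (by decide)
  have e6 := key 0 4 1 2 (by decide)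
  have e7 := key 0 1 3 4 (by decide)
  have e8 := key 0 3 1 4 (by decide)
  have e9 := key 0 4 1 3 (by decide)
  have e10 := key 0 2 3 4 (by decide)
  have e11 := key 0 3 2 4 (by decide)
  have e12 := key 0 4 2 3 (by decide)
  have e13 := key 1 2 3 4 (by decide)
  have e14 := key 1 3 2 4 (by decide)
  have e15 := key 1 4 2 3 (by decide)
  simp [Fin.lt_def] at e1 e2 e3 e4 e5 e6 e7 e8 e9 e10 e11 e12 e13 e14 e15
  omega

/-! ### Graphs with an independent drawing have at most `3 n - 6` edges -/

variable {V W : Type*}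

theorem HasIndependentDrawing.of_hom {G : SimpleGraph V} {H : SimpleGraph W}
    (hG : G.HasIndependentDrawing) (f : H →g G) (hf : Function.Injective f) :
    H.HasIndependentDrawing := by
  obtain ⟨p, γ, h⟩ := hG
  exact ⟨fun w => p (f w), fun a b => γ (f a) (f b), fun a b c d hab hcd h1 h2 h3 h4 =>
    h _ _ _ _ (f.map_adj hab) (f.map_adj hcd) (hf.ne h1) (hf.ne h2) (hf.ne h3) (hf.ne h4)⟩

theorem HasIndependentDrawing.mono {G H : SimpleGraph V} (hG : G.HasIndependentDrawing)
    (h : H ≤ G) : H.HasIndependentDrawing :=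
  hG.of_hom (Hom.ofLE h) fun _ _ => id

theorem HasIndependentDrawing.cliqueFree {G : SimpleGraph V} (hG : G.HasIndependentDrawing) :
    G.CliqueFree 5 := by
  by_contra h
  obtain ⟨f⟩ := not_cliqueFree_iff_top_isContained 5 |>.1 h
  exact not_hasIndependentDrawing_top (hG.of_hom f.toHom f.injective)

/-- The graph obtained by moving the edges at `y` to `x` and so isolating `y`; the contraction
of `xy` if these vertices are adjacent. -/
def contract (G : SimpleGraph V) (x y : V) : SimpleGraph V where
  Adj a b := a ≠ b ∧ a ≠ y ∧ b ≠ y ∧ (G.Adj a b ∨ (a = x ∨ b = x) ∧ G.Adj a y ∧ G.Adj y b)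
  symm.symm a b h := by
    have h1 := G.adj_comm a b
    have h2 := G.adj_comm a y
    have h3 := G.adj_comm b y
    tauto
  loopless.irrefl a h := h.1 rfl

/-- A new edge is drawn along the two old edges through y. All new edges have the end x, so two
independent edges are never both new. Hence each point of an arc lies on an old edge, and the two
old edges in question are still independent. -/
theorem HasIndependentDrawing.contract {G : SimpleGraph V} (hG : G.HasIndependentDrawing)
    (x y : V) : (G.contract x y).HasIndependentDrawing := by
  classical
  obtain ⟨p, γ, h⟩ := hG
  let γ' : ∀ a b, _root_.Path (p a) (p b) := fun a b =>
    if G.Adj a b then γ a b else (γ a y).trans (γ y b)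
  have key : ∀ a b s, (G.contract x y).Adj a b → ∃ u v t, G.Adj u v ∧ γ' a b s = γ u v t ∧
      (u = a ∧ v = b ∨ (a = x ∨ b = x) ∧ (u = a ∧ v = y ∨ u = y ∧ v = b)) := by
    rintro a b s ⟨hab, hay, hby, hadj⟩
    by_cases hG : G.Adj a b
    · exact ⟨a, b, s, hG, by simp [γ', hG], .inl ⟨rfl, rfl⟩⟩
    · obtain ⟨hx, h1, h2⟩ := hadj.resolve_left hG
      have hmem : γ' a b s ∈ Set.range ((γ a y).trans (γ y b)) := ⟨s, by simp [γ', hG]⟩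
      rw [Path.trans_range] at hmem
      rcases hmem with ⟨t, ht⟩ | ⟨t, ht⟩
      · exact ⟨a, y, t, h1, ht.symm, .inr ⟨hx, .inl ⟨rfl, rfl⟩⟩⟩
      · exact ⟨y, b, t, h2, ht.symm, .inr ⟨hx, .inr ⟨rfl, rfl⟩⟩⟩
  refine ⟨p, γ', fun a b c d hab hcd hac had hbc hbd s t hst => ?_⟩
  obtain ⟨u, v, s', huv, hs, h1⟩ := key a b s hab
  obtain ⟨w, z, t', hwz, ht, h2⟩ := key c d t hcd
  have h3 := hab.2.1
  have h4 := hab.2.2.1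
  have h5 := hcd.2.1
  have h6 := hcd.2.2.1
  rw [hs, ht] at hst
  refine h u v w z huv hwz ?_ ?_ ?_ ?_ s' t' hst <;> grind

open Classical in
-- Contraction loses the edge xy and, for each common neighbor, one of two edges that become
-- parallel.
theorem card_edgeFinset_le_contract [Fintype V] {G : SimpleGraph V} {x y : V} (hxy : G.Adj x y) :
    G.edgeFinset.card ≤ (G.contract x y).edgeFinset.card + 1 +
      (G.neighborFinset x ∩ G.neighborFinset y).card := by
  set T := (G.neighborFinset y \ G.neighborFinset x).erase x with hT
  have hsub : (G.deleteIncidenceSet y).edgeFinset ∪ T.image (fun z => s(x, z)) ⊆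
      (G.contract x y).edgeFinset := by
    intro e
    induction e with
    | _ a b =>
      simp only [Finset.mem_union, mem_edgeFinset, mem_edgeSet, deleteIncidenceSet_adj,
        Finset.mem_image, hT, Finset.mem_erase, Finset.mem_sdiff, mem_neighborFinset]
      rintro (⟨hab, ha, hb⟩ | ⟨z, ⟨hzx, hyz, hxz⟩, hz⟩)
      · exact ⟨hab.ne, ha, hb, .inl hab⟩
      · change s(x, z) = s(a, b) at hz
        rw [← mem_edgeSet, ← hz, mem_edgeSet]
        exact ⟨hzx.symm, hxy.ne, hyz.ne', .inr ⟨.inl rfl, hxy, hyz⟩⟩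
  have hdisj : Disjoint (G.deleteIncidenceSet y).edgeFinset (T.image (fun z => s(x, z))) := by
    rw [Finset.disjoint_left]
    intro e he he'
    obtain ⟨z, hz, rfl⟩ := Finset.mem_image.1 he'
    simp only [hT, Finset.mem_erase, Finset.mem_sdiff, mem_neighborFinset] at hz
    simp only [mem_edgeFinset, mem_edgeSet, deleteIncidenceSet_adj] at he
    exact hz.2.2 he.1
  have hcard := Finset.card_le_card hsub
  rw [Finset.card_union_of_disjoint hdisj, card_edgeFinset_deleteIncidenceSet,
    Finset.card_image_of_injective _ (fun a b h => Sym2.congr_right.1 h)] at hcard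
  have hTc : T.card + 1 = (G.neighborFinset y \ G.neighborFinset x).card := by
    apply Finset.card_erase_add_one
    simp [hxy.symm]
  have hdeg := Finset.card_sdiff_add_card_inter (G.neighborFinset y) (G.neighborFinset x)
  rw [card_neighborFinset_eq_degree] at hdeg
  rw [Finset.inter_comm]
  omega

/-- Five vertices in the neighbourhood of `v` with a non-adjacent pair `b`, `c` and all other
adjacencies except possibly `de` give a `K₅` after contraction of `bd`. -/
theorem HasIndependentDrawing.false_of_nearly_complete {G : SimpleGraph V}
    (hG : G.HasIndependentDrawing) {v a b c d e : V} (hva : G.Adj v a) (hvb : G.Adj v b)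
    (hvc : G.Adj v c) (hvd : G.Adj v d) (hve : G.Adj v e) (hab : G.Adj a b) (hac : G.Adj a c)
    (had : G.Adj a d) (hae : G.Adj a e) (hbd : G.Adj b d) (hbe : G.Adj b e) (hcd : G.Adj c d)
    (hce : G.Adj c e) (hbc : b ≠ c) (hde : d ≠ e) : False := by
  classical
  refine (hG.contract d b).cliqueFree {v, a, d, c, e} ?_
  have h1 := hva.ne
  have h2 := hvb.ne
  have h3 := hvc.ne
  have h4 := hvd.ne
  have h5 := hve.ne
  have h6 := hab.ne
  have h7 := hac.ne
  have h8 := had.ne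
  have h9 := hae.ne
  have h10 := hbd.ne
  have h11 := hbe.ne
  have h12 := hcd.ne
  have h13 := hce.ne
  have h : (G.contract d b).IsNClique 3 {d, c, e} := is3Clique_triple_iff.2 (by
    simp [SimpleGraph.contract, *, G.adj_comm, Ne.symm])
  refine (h.insert (a := a) fun u hu => ?_).insert (a := v) fun u hu => ?_ <;>
    simp only [Finset.mem_insert, Finset.mem_singleton] at hu <;>
    simp only [SimpleGraph.contract] <;> grind

open Classical in
-- The set `S` carries the vertex count, because `contract` isolates a vertex instead of removing it
-- from the type. The induction deletes a vertex or contracts an edge, and ends in the neighborhood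
-- of a vertex of small degree.
theorem HasIndependentDrawing.card_edgeFinset_add_six_le [Fintype V] :
    ∀ (n : ℕ) (S : Finset V) (G : SimpleGraph V), G.HasIndependentDrawing → S.card = n + 3 →
      (∀ a b, G.Adj a b → a ∈ S) → G.edgeFinset.card + 6 ≤ 3 * (n + 3) := by
  intro n
  induction n with
  | zero =>
    intro S G hG hS hsupp
    have hdeg : ∀ v ∈ S, G.degree v ≤ 2 := by
      intro v hv
      rw [← card_neighborFinset_eq_degree]
      have : G.neighborFinset v ⊆ S.erase v := fun w hw => by
        rw [mem_neighborFinset] at hw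
        exact Finset.mem_erase.2 ⟨hw.ne', hsupp _ _ hw.symm⟩
      have := Finset.card_le_card this
      rw [Finset.card_erase_of_mem hv] at this
      omega
    have hsum := G.sum_degrees_eq_twice_card_edges
    rw [← Finset.sum_subset (Finset.subset_univ S) fun v _ hv => by
      rw [← card_neighborFinset_eq_degree, Finset.card_eq_zero, Finset.eq_empty_iff_forall_notMem]
      exact fun w hw => hv (hsupp v w (by simpa using hw))] at hsum
    have := Finset.sum_le_card_nsmul S (fun v => G.degree v) 2 hdeg
    rw [hS, smul_eq_mul] at this
    omega
  | succ n ih =>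
    intro S G₀ hG₀ hS hsupp₀
    by_contra! hlt
    obtain ⟨T, hTsub, hTcard⟩ := Finset.exists_subset_card_eq
      (show 3 * n + 7 ≤ G₀.edgeFinset.card by omega)
    -- Keeping exactly one edge too many bounds the degree sum from above, which later yields a
    -- vertex of degree at most 5.
    obtain ⟨G, hle, hcard⟩ : ∃ G : SimpleGraph V, G ≤ G₀ ∧ G.edgeFinset.card = 3 * n + 7 := by
      refine ⟨fromEdgeSet (T : Set (Sym2 V)), ?_, ?_⟩
      · intro a b hab
        rw [fromEdgeSet_adj] at hab
        simpa using hTsub hab.1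
      · rw [← hTcard]
        congr 1
        ext e
        simp only [mem_edgeFinset, edgeSet_fromEdgeSet, Set.mem_sdiff, Finset.mem_coe]
        exact ⟨fun h => h.1, fun h => ⟨h, G₀.not_isDiag_of_mem_edgeSet
          (mem_edgeFinset.1 (hTsub h))⟩⟩
    have hG := hG₀.mono hle
    have hsupp : ∀ a b, G.Adj a b → a ∈ S := fun a b h => hsupp₀ a b (hle h)
    clear! G₀ T
    have herase : ∀ v ∈ S, (S.erase v).card = n + 3 := fun v hv => by
      rw [Finset.card_erase_of_mem hv]; omega
    -- By induction the contraction has at most 3n + 3 edges, four fewer than `G`; one of them is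
    -- xy, so three common neighbors account for the rest.
    have hcommon : ∀ x y, G.Adj x y → 3 ≤ (G.neighborFinset x ∩ G.neighborFinset y).card := by
      intro x y hxy
      have h1 := card_edgeFinset_le_contract hxy
      have h2 := ih (S.erase y) (G.contract x y) (hG.contract x y) (herase y (hsupp _ _ hxy.symm))
        (fun a b hab => Finset.mem_erase.2 ⟨hab.2.1, by
          rcases hab.2.2.2 with h | h
          · exact hsupp _ _ h
          · exact hsupp _ _ h.2.1⟩)
      omega
    obtain ⟨v, hvS, hv⟩ : ∃ v ∈ S, G.degree v ≤ 5 := by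
      by_contra! hbig
      have hsum := G.sum_degrees_eq_twice_card_edges
      have h1 := Finset.card_nsmul_le_sum S (fun v => G.degree v) 6 hbig
      have h2 := Finset.sum_le_univ_sum_of_nonneg (s := S) (f := fun v => G.degree v)
        fun _ => Nat.zero_le _
      rw [hS, smul_eq_mul] at h1
      omega
    have hv3 : 4 ≤ G.degree v := by
      by_contra! hsmall
      have h1 := ih (S.erase v) (G.deleteIncidenceSet v) (hG.mono (deleteIncidenceSet_le _ _))
        (herase v hvS) (fun a b hab => by
          rw [deleteIncidenceSet_adj] at hab
          exact Finset.mem_erase.2 ⟨hab.2.1, hsupp _ _ hab.1⟩)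
      have h2 : ∀ _ : Fintype (G.deleteIncidenceSet v).edgeSet,
          (G.deleteIncidenceSet v).edgeFinset.card = G.edgeFinset.card - G.degree v := fun _ => by
        convert G.card_edgeFinset_deleteIncidenceSet v
      rw [h2] at h1
      omega
    set N := G.neighborFinset v with hN
    have hNcard : N.card = G.degree v := card_neighborFinset_eq_degree ..
    have hmem : ∀ {u}, u ∈ N ↔ G.Adj v u := by simp [hN]
    have hclique : ∀ s : Finset V, s.card = 5 → ¬ (s : Set V).Pairwise G.Adj := fun s hs h =>
      hG.cliqueFree s ⟨h, hs⟩
    have hNu : ∀ u ∈ N, 3 ≤ (N ∩ G.neighborFinset u).card := fun u hu => hcommon v u (hmem.1 hu)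
    obtain h4 | h5 : N.card = 4 ∨ N.card = 5 := by omega
    -- Three neighbors inside a set of four leave no non-adjacent pair, so v and its neighborhood
    -- form K₅.
    · have hadj : ∀ u ∈ N, ∀ w ∈ N, u ≠ w → G.Adj u w := by
        intro u hu w hw huw
        have hsub : N ∩ G.neighborFinset u ⊆ N.erase u := fun z hz => by
          simp only [Finset.mem_inter, mem_neighborFinset] at hz
          exact Finset.mem_erase.2 ⟨hz.2.ne', hz.1⟩
        have heq := Finset.eq_of_subset_of_card_le hsub (by
          rw [Finset.card_erase_of_mem hu, h4]; exact hNu u hu)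
        have : w ∈ N ∩ G.neighborFinset u := heq ▸ Finset.mem_erase.2 ⟨huw.symm, hw⟩
        simpa using (Finset.mem_inter.1 this).2
      refine hclique (insert v N) ?_ ?_
      · rw [Finset.card_insert_of_notMem (by simp [hN]), h4]
      · rw [Finset.coe_insert, Set.pairwise_insert]
        exact ⟨fun u hu w hw => hadj u hu w hw, fun u hu _ => ⟨hmem.1 hu, (hmem.1 hu).symm⟩⟩
    -- Each of the five neighbors misses at most one other: the non-edges inside `N` form a
    -- matching.
    · have hmiss : ∀ u ∈ N, ∀ w ∈ N, ∀ z ∈ N, u ≠ w → u ≠ z → w ≠ z → G.Adj u w ∨ G.Adj u z := by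
        intro u hu w hw z hz huw huz hwz
        by_contra! hcon
        have hsub : N ∩ G.neighborFinset u ⊆ ((N.erase u).erase w).erase z := fun t ht => by
          simp only [Finset.mem_inter, mem_neighborFinset] at ht
          simp only [Finset.mem_erase]
          exact ⟨fun h => hcon.2 (h ▸ ht.2), fun h => hcon.1 (h ▸ ht.2), ht.2.ne', ht.1⟩
        have h1 := (hNu u hu).trans (Finset.card_le_card hsub)
        rw [Finset.card_erase_of_mem (by simp [hz, Ne.symm huz, Ne.symm hwz]),
          Finset.card_erase_of_mem (by simp [hw, Ne.symm huw]), Finset.card_erase_of_mem hu] at h1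
        omega
      have hpair := hclique N h5
      simp only [Set.Pairwise, Finset.mem_coe] at hpair
      push Not at hpair
      obtain ⟨b, hb, c, hc, hbc, hnbc⟩ := hpair
      obtain ⟨a, d, e, had, hae, hde, hR⟩ := Finset.card_eq_three.1
        (show ((N.erase b).erase c).card = 3 by
          rw [Finset.card_erase_of_mem (by simp [hc, Ne.symm hbc]), Finset.card_erase_of_mem hb, h5])
      have hR' : ∀ z, z ∈ ({a, d, e} : Finset V) → z ≠ c ∧ z ≠ b ∧ z ∈ N := fun z hz => by
        simpa [← hR] using hz
      obtain ⟨hac, hab, ha⟩ := hR' a (by simp)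
      obtain ⟨hdc, hdb, hd⟩ := hR' d (by simp)
      obtain ⟨hec, heb, he⟩ := hR' e (by simp)
      have hnb : ∀ z ∈ N, z ≠ b → z ≠ c → G.Adj b z ∧ G.Adj c z := fun z hz hzb hzc =>
        ⟨(hmiss b hb c hc z hz hbc hzb.symm hzc.symm).resolve_left hnbc,
          (hmiss c hc b hb z hz hbc.symm hzc.symm hzb.symm).resolve_left fun h => hnbc h.symm⟩
      have hcon : ∀ a ∈ N, ∀ d ∈ N, ∀ e ∈ N, a ≠ b → a ≠ c → d ≠ b → d ≠ c → e ≠ b → e ≠ c →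
          d ≠ e → G.Adj a d → G.Adj a e → False :=
        fun a ha d hd e he hab hac hdb hdc heb hec hde had hae =>
          hG.false_of_nearly_complete (hmem.1 ha) (hmem.1 hb) (hmem.1 hc) (hmem.1 hd) (hmem.1 he)
            (hnb a ha hab hac).1.symm (hnb a ha hab hac).2.symm had hae (hnb d hd hdb hdc).1
            (hnb e he heb hec).1 (hnb d hd hdb hdc).2 (hnb e he heb hec).2 hbc hde
      -- At most one pair among a, d, e is non-adjacent, so one of the three is adjacent to the
      -- other two and `hcon` applies to it.
      have m1 := hmiss a ha d hd e he had hae hde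
      have m2 := hmiss d hd a ha e he had.symm hde hae
      have m3 := hmiss e he a ha d hd hae.symm hde.symm had
      have c1 := hcon a ha d hd e he hab hac hdb hdc heb hec hde
      have c2 := hcon d hd a ha e he hdb hdc hab hac heb hec hae
      have c3 := hcon e he a ha d hd heb hec hab hac hdb hdc had
      have s1 := G.adj_comm a d
      have s2 := G.adj_comm a e
      have s3 := G.adj_comm d e
      clear * - m1 m2 m3 c1 c2 c3 s1 s2 s3
      tauto

theorem IsPlanar.hasIndependentDrawing {G : SimpleGraph V} (hG : G.IsPlanar) :
    G.HasIndependentDrawing := by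
  classical
  obtain ⟨E⟩ := hG
  let ψ : ℝ × ℝ → ℂ := Complex.equivRealProdCLM.symm
  have hψ : Continuous ψ := Complex.equivRealProdCLM.symm.continuous
  have hψi : Function.Injective ψ := Complex.equivRealProdCLM.symm.injective
  have hpath : ∀ a b, ∃ γ : _root_.Path (ψ (E.point a)) (ψ (E.point b)), ∀ h : G.Adj a b,
      ∀ t, ∃ s, γ t = ψ (E.arc ⟨s(a, b), h⟩ s) := by
    intro a b
    by_cases h : G.Adj a b
    · have hends := E.arc_ends ⟨s(a, b), h⟩
      have himg : E.point '' {v | v ∈ s(a, b)} = {E.point a, E.point b} := by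
        ext z; simp [eq_comm]
      rw [himg] at hends
      have hcont := E.arc_continuous ⟨s(a, b), h⟩
      rcases Set.pair_eq_pair_iff.1 hends with ⟨h0, h1⟩ | ⟨h0, h1⟩
      · exact ⟨⟨⟨fun t => ψ (E.arc ⟨s(a, b), h⟩ t), hψ.comp hcont⟩, by simp [h0], by simp [h1]⟩,
          fun _ t => ⟨t, rfl⟩⟩
      · exact ⟨⟨⟨fun t => ψ (E.arc ⟨s(a, b), h⟩ (σ t)),
          hψ.comp (hcont.comp unitInterval.continuous_symm)⟩, by simp [h1], by simp [h0]⟩,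
          fun _ t => ⟨σ t, rfl⟩⟩
    · exact ⟨PathConnectedSpace.somePath _ _, fun h' => absurd h' h⟩
  choose γ hγ using hpath
  refine ⟨fun v => ψ (E.point v), γ, fun a b c d hab hcd hac had hbc hbd s t hst => ?_⟩
  obtain ⟨s', hs⟩ := hγ a b hab s
  obtain ⟨t', ht⟩ := hγ c d hcd t
  rw [hs, ht] at hst
  have heq := hψi hst
  have hne : (⟨s(a, b), hab⟩ : G.edgeSet) ≠ ⟨s(c, d), hcd⟩ := by
    simp [Subtype.ext_iff, hac, had]
  obtain ⟨v, hv⟩ := E.arc_inter_subset _ _ hne ⟨⟨s', rfl⟩, ⟨t', heq.symm⟩⟩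
  have h1 := E.mem_of_point_mem_arc ⟨s(a, b), hab⟩ v ⟨s', hv.symm⟩
  have h2 := E.mem_of_point_mem_arc ⟨s(c, d), hcd⟩ v ⟨t', by rw [hv, heq]⟩
  simp only [Sym2.mem_iff] at h1 h2
  grind

open Classical in
/-- A planar graph on `n ≥ 3` vertices has at most `3 n - 6` edges. -/
theorem IsPlanar.card_edgeFinset_le [Fintype V] {G : SimpleGraph V} (hG : G.IsPlanar)
    (hV : 3 ≤ Fintype.card V) : G.edgeFinset.card ≤ 3 * Fintype.card V - 6 := by
  have := HasIndependentDrawing.card_edgeFinset_add_six_le (Fintype.card V - 3) Finset.univ G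
    hG.hasIndependentDrawing (by rw [Finset.card_univ]; omega) fun _ _ _ => Finset.mem_univ _
  omega

/-! ### The layered triangulation

It has `k - 3` concentric rings of `k` vertices each and two poles. Its vertices are described by
lattice points `(i, j)` with a row `0 ≤ i ≤ k - 2` and a column `j` modulo `k`, where all the points
of row `0` and all those of row `k - 2` are identified. -/

/-- The three directions of edges of the triangular lattice. -/
inductive LatticeDir
  | horizontal
  | vertical
  | diagonal
  deriving DecidableEq

namespace LatticeDir

instance : Fintype LatticeDir :=
  ⟨{horizontal, vertical, diagonal}, by rintro (_ | _ | _) <;> decide⟩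

/-- The change of the row along an edge. -/
def row : LatticeDir → ℤ
  | horizontal => 0
  | vertical => 1
  | diagonal => 1

/-- The change of the column along an edge. -/
def col : LatticeDir → ℤ
  | horizontal => 1
  | vertical => 0
  | diagonal => -1

end LatticeDir

open LatticeDir

/-- Two poles and `k - 3` rings of `k` vertices. -/
abbrev LayeredVertex (k : ℕ) : Type := Bool ⊕ Fin (k - 3) × ZMod k

/-- The vertex at a lattice point. -/
def latticeVertex (k : ℕ) (i : ℤ) (j : ZMod k) : LayeredVertex k :=
  if i ≤ 0 then .inl false
  else if h : (i - 1).toNat < k - 3 then .inr (⟨(i - 1).toNat, h⟩, j) else .inl true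

theorem latticeVertex_eq_iff {k : ℕ} {i i' : ℤ} {j j' : ZMod k} (hk : 5 ≤ k) (hi : 0 ≤ i)
    (hik : i ≤ k - 2) (hi' : 0 ≤ i') (hik' : i' ≤ k - 2) :
    latticeVertex k i j = latticeVertex k i' j' ↔ i = i' ∧ (i = 0 ∨ i = k - 2 ∨ j = j') := by
  unfold latticeVertex
  split_ifs <;> simp <;> grind

theorem exists_eq_latticeVertex {k : ℕ} (hk : 5 ≤ k) (x : LayeredVertex k) :
    ∃ (i : ℤ) (j : ZMod k), 0 ≤ i ∧ i ≤ k - 2 ∧ x = latticeVertex k i j := by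
  rcases x with (_ | _) | ⟨i, j⟩
  · exact ⟨0, 0, by omega, by omega, by simp [latticeVertex]⟩
  · refine ⟨k - 2, 0, by omega, by omega, ?_⟩
    rw [latticeVertex, if_neg (by omega), dif_neg (by omega)]
  · refine ⟨i + 1, j, by omega, by omega, ?_⟩
    rw [latticeVertex, if_neg (by omega), dif_pos (by omega)]
    simp

/-- The rows in which edges of a given direction start. -/
def LatticeDir.StartsAt (k : ℕ) : LatticeDir → ℤ → Prop
  | horizontal, i => 1 ≤ i ∧ i ≤ k - 3
  | vertical, i => 0 ≤ i ∧ i ≤ k - 3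
  | diagonal, i => 1 ≤ i ∧ i ≤ k - 4

/-- Edges of the layered triangulation, given by a direction and a starting point. -/
abbrev LayeredEdge (k : ℕ) : Type :=
  {e : LatticeDir × ℤ × ZMod k // e.1.StartsAt k e.2.1}

namespace LayeredEdge

variable {k : ℕ}

/-- The direction of an edge. -/
abbrev dir (e : LayeredEdge k) : LatticeDir := e.1.1

/-- The row of the starting point. -/
abbrev row (e : LayeredEdge k) : ℤ := e.1.2.1

/-- The column of the starting point. -/
abbrev col (e : LayeredEdge k) : ZMod k := e.1.2.2

/-- The starting point of an edge. -/
def src (e : LayeredEdge k) : LayeredVertex k := latticeVertex k e.row e.col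

/-- The end point of an edge. -/
def tgt (e : LayeredEdge k) : LayeredVertex k :=
  latticeVertex k (e.row + e.dir.row) (e.col + e.dir.col)

/-- The two ends of an edge. -/
def ends (e : LayeredEdge k) : Sym2 (LayeredVertex k) := s(e.src, e.tgt)

end LayeredEdge

/-- The color of an edge of a given direction that starts at a given point. -/
def latticeColor (k : ℕ) : LatticeDir → ℤ → ZMod k → ZMod k ⊕ ZMod 2
  | horizontal, _, j => .inl (j - 1)
  | vertical, i, j => .inl (i + j)
  | diagonal, i, _ => .inr i

/-- The color of an edge. -/
def LayeredEdge.color {k : ℕ} (e : LayeredEdge k) : ZMod k ⊕ ZMod 2 :=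
  latticeColor k e.dir e.row e.col

theorem eq_zero_of_intCast_zmod {k : ℕ} {a : ℤ} (h : (a : ZMod k) = 0) (h1 : -k < a) (h2 : a < k) :
    a = 0 :=
  Int.eq_zero_of_abs_lt_dvd ((ZMod.intCast_zmod_eq_zero_iff_dvd _ _).1 h) (abs_lt.2 ⟨h1, h2⟩)

namespace LayeredEdge

variable {k : ℕ}

theorem row_nonneg (e : LayeredEdge k) : 0 ≤ e.row := by
  obtain ⟨⟨d, i, j⟩, h⟩ := e
  cases d <;> simp only [StartsAt, LayeredEdge.row] at h ⊢ <;> omega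

theorem row_add_le (e : LayeredEdge k) : e.row + e.dir.row ≤ k - 2 := by
  obtain ⟨⟨d, i, j⟩, h⟩ := e
  cases d <;> simp only [StartsAt, LayeredEdge.row, LatticeDir.row] at h ⊢ <;> omega

theorem dir_row_nonneg (d : LatticeDir) : 0 ≤ d.row := by cases d <;> simp [LatticeDir.row]

theorem latticeVertex_eq_src_iff (hk : 5 ≤ k) (e : LayeredEdge k) {i : ℤ} {j : ZMod k}
    (hi : 0 ≤ i) (hik : i ≤ k - 2) :
    latticeVertex k i j = e.src ↔ i = e.row ∧ (i = 0 ∨ i = k - 2 ∨ j = e.col) :=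
  latticeVertex_eq_iff hk hi hik e.row_nonneg
    (by have := e.row_add_le; have := dir_row_nonneg e.dir; omega)

theorem latticeVertex_eq_tgt_iff (hk : 5 ≤ k) (e : LayeredEdge k) {i : ℤ} {j : ZMod k}
    (hi : 0 ≤ i) (hik : i ≤ k - 2) :
    latticeVertex k i j = e.tgt ↔
      i = e.row + e.dir.row ∧ (i = 0 ∨ i = k - 2 ∨ j = e.col + e.dir.col) :=
  latticeVertex_eq_iff hk hi hik
    (by have := e.row_nonneg; have := dir_row_nonneg e.dir; omega) e.row_add_le

/-- A diagonal at a pole would be parallel to a vertical edge, which is why `StartsAt` excludes it.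
A horizontal edge read backwards is excluded by 2 ≠ 0 modulo k. -/
theorem ends_injective (hk : 5 ≤ k) : Function.Injective (ends : LayeredEdge k → _) := by
  intro e f hef
  have hone : ((1 : ℤ) : ZMod k) ≠ 0 := fun h => by
    have := eq_zero_of_intCast_zmod h (by omega) (by omega); omega
  have htwo : ((2 : ℤ) : ZMod k) ≠ 0 := fun h => by
    have := eq_zero_of_intCast_zmod h (by omega) (by omega); omega
  have e1 := e.row_nonneg
  have e2 := e.row_add_le
  have e3 := dir_row_nonneg e.dir
  rw [ends, ends, Sym2.eq_iff, show e.src = latticeVertex k e.row e.col from rfl,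
    show e.tgt = latticeVertex k (e.row + e.dir.row) (e.col + e.dir.col) from rfl,
    latticeVertex_eq_src_iff hk _ e1 (by omega), latticeVertex_eq_tgt_iff hk _ e1 (by omega),
    latticeVertex_eq_src_iff hk _ (by omega) e2, latticeVertex_eq_tgt_iff hk _ (by omega) e2] at hef
  obtain ⟨⟨d, i, j⟩, h⟩ := e
  obtain ⟨⟨d', i', j'⟩, h'⟩ := f
  have hs : d.StartsAt k i := h
  have hs' : d'.StartsAt k i' := h'
  simp only [Subtype.mk.injEq, Prod.mk.injEq]
  cases d <;> cases d' <;> simp only [StartsAt, LayeredEdge.row, LayeredEdge.col, LatticeDir.row, LatticeDir.col] at * <;>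
    push_cast at * <;> grind

/-- At a ring vertex (i, j) the horizontal colors are j - 1 and j - 2, the vertical ones i + j and i
+ j - 1, the diagonal ones i and i - 1 modulo 2. A clash of horizontal and vertical would force i ≡
0, -1 or -2 modulo k, impossible for 1 ≤ i ≤ k - 3. At a pole the colors are translates of the
columns. -/
theorem eq_of_color_eq (hk : 5 ≤ k) {e f : LayeredEdge k} {x : LayeredVertex k} (he : x ∈ e.ends)
    (hf : x ∈ f.ends) (hc : e.color = f.color) : e = f := by
  have hsmall : ∀ a : ℤ, 0 < a → a < k → (a : ZMod k) ≠ 0 := fun a h1 h2 h => by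
    have := eq_zero_of_intCast_zmod h (by omega) h2; omega
  obtain ⟨r, c, h1, h2, rfl⟩ := exists_eq_latticeVertex hk x
  rw [ends, Sym2.mem_iff, latticeVertex_eq_src_iff hk _ h1 h2,
    latticeVertex_eq_tgt_iff hk _ h1 h2] at he hf
  obtain ⟨⟨d, i, j⟩, h⟩ := e
  obtain ⟨⟨d', i', j'⟩, h'⟩ := f
  have hs : d.StartsAt k i := h
  have hs' : d'.StartsAt k i' := h'
  simp only [Subtype.mk.injEq, Prod.mk.injEq]
  have hone : (1 : ZMod 2) ≠ 0 := by decide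
  have a1 := hsmall 1 (by omega) (by omega)
  have a2 := hsmall (i + 1)
  have a3 := hsmall (i + 2)
  have a4 := hsmall (i' + 1)
  have a5 := hsmall (i' + 2)
  have b1 : ∀ n : ℕ, i = i' + 1 → (i : ZMod n) = i' + 1 := by rintro n rfl; push_cast; rfl
  have b2 : ∀ n : ℕ, i' = i + 1 → (i' : ZMod n) = i + 1 := by rintro n rfl; push_cast; rfl
  replace b1 := And.intro (b1 k) (b1 2)
  replace b2 := And.intro (b2 k) (b2 2)
  cases d <;> cases d' <;>
    simp only [StartsAt, LayeredEdge.row, LayeredEdge.col, LatticeDir.row, LatticeDir.col, color, latticeColor,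
      Sum.inl.injEq, Sum.inr.injEq, reduceCtorEq] at * <;>
    push_cast at * <;> grind

end LayeredEdge

/-! ### Four-cycles of the layered triangulation -/

/-- A step of the lattice along or against a direction. -/
abbrev LatticeStep : Type := LatticeDir × Bool

namespace LatticeStep

/-- The change of the row in a step. -/
def row (s : LatticeStep) : ℤ := if s.2 then s.1.row else -s.1.row

/-- The change of the column in a step. -/
def col (s : LatticeStep) : ℤ := if s.2 then s.1.col else -s.1.col

/-- The step back. -/
def reverse (s : LatticeStep) : LatticeStep := (s.1, !s.2)

theorem abs_col_le (s : LatticeStep) : -1 ≤ s.col ∧ s.col ≤ 1 := by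
  revert s; decide

theorem row_reverse (s : LatticeStep) : s.reverse.row = -s.row := by
  revert s; decide

theorem col_reverse (s : LatticeStep) : s.reverse.col = -s.col := by
  revert s; decide

/-- A closed walk of length four in the triangular lattice without backtracking goes around a
rhombus. -/
theorem eq_reverse_of_closed : ∀ s t u v : LatticeStep,
    (s.row + t.row + u.row + v.row = 0 ∧ s.col + t.col + u.col + v.col = 0 ∧
      t ≠ s.reverse ∧ u ≠ t.reverse ∧ v ≠ u.reverse) →
    u = s.reverse ∧ v = t.reverse ∧ t.1 ≠ s.1 := by
  decide +kernel

end LatticeStep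

/-- The color of the edge along which a step from a given point goes. -/
def stepColor (k : ℕ) (s : LatticeStep) (i : ℤ) (j : ZMod k) : ZMod k ⊕ ZMod 2 :=
  if s.2 then latticeColor k s.1 i j else latticeColor k s.1 (i - s.1.row) (j - s.1.col)

/-- Horizontal and vertical: the horizontal sides agree. Horizontal and diagonal: the diagonal sides
agree. Vertical and diagonal: the vertical sides agree, as i + j does not change along a diagonal.
-/
theorem stepColor_rhombus (k : ℕ) (s t : LatticeStep) (hst : t.1 ≠ s.1) (i : ℤ) (j : ZMod k) :
    stepColor k s i j = stepColor k s.reverse (i + s.row + t.row) (j + s.col + t.col) ∨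
    stepColor k t (i + s.row) (j + s.col) = stepColor k t.reverse (i + t.row) (j + t.col) := by
  obtain ⟨d, b⟩ := s
  obtain ⟨d', b'⟩ := t
  cases d <;> cases d' <;> first | exact absurd rfl hst | skip
  all_goals
    cases b <;> cases b' <;>
    simp [stepColor, latticeColor, LatticeStep.reverse, LatticeStep.row, LatticeStep.col,
      LatticeDir.row, LatticeDir.col] <;> ring_nf <;> simp

/-- At a ring vertex, unlike at a pole, the column is determined, so an edge there is a definite
lattice step. -/
theorem exists_step {k : ℕ} (hk : 5 ≤ k) {e : LayeredEdge k} {i : ℤ} {j : ZMod k} {b : LayeredVertex k} (hi : 1 ≤ i)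
    (hik : i ≤ k - 3) (he : e.ends = s(latticeVertex k i j, b)) :
    ∃ s : LatticeStep, b = latticeVertex k (i + s.row) (j + s.col) ∧ 0 ≤ i + s.row ∧
      i + s.row ≤ k - 2 ∧ e.color = stepColor k s i j := by
  have h0 := e.row_nonneg
  have h1 := e.row_add_le
  have h2 := LayeredEdge.dir_row_nonneg e.dir
  rw [LayeredEdge.ends, Sym2.eq_iff] at he
  rcases he with ⟨ha, hb⟩ | ⟨hb, ha⟩
  · rw [eq_comm, LayeredEdge.latticeVertex_eq_src_iff hk _ (by omega) (by omega)] at ha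
    obtain ⟨hr, hc'⟩ := ha
    have hc : j = e.col := by
      rcases hc' with hc | hc | hc
      · omega
      · omega
      · exact hc
    subst hr
    subst hc
    refine ⟨(e.dir, true), hb.symm, ?_, ?_, rfl⟩ <;> simp only [LatticeStep.row, if_true] <;> omega
  · rw [eq_comm, LayeredEdge.latticeVertex_eq_tgt_iff hk _ (by omega) (by omega)] at ha
    obtain ⟨hr, hc⟩ := ha
    have hc : j = e.col + e.dir.col := by
      rcases hc with hc | hc | hc
      · omega
      · omega
      · exact hc
    refine ⟨(e.dir, false), ?_, ?_, ?_, ?_⟩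
    · rw [← hb]
      simp [LayeredEdge.src, LatticeStep.row, LatticeStep.col, hr, hc]
    · simp [LatticeStep.row, hr]; omega
    · simp [LatticeStep.row, hr]; omega
    · simp [LayeredEdge.color, stepColor, hr, hc]

theorem exists_of_ends_top {k : ℕ} (hk : 5 ≤ k) {e : LayeredEdge k} {b : LayeredVertex k} {i : ℤ} {j : ZMod k}
    (hi : i = 0) (he : e.ends = s(latticeVertex k i j, b)) :
    ∃ c : ZMod k, b = latticeVertex k 1 c ∧ e.color = .inl c := by
  have h0 := e.row_nonneg
  rw [LayeredEdge.ends, Sym2.eq_iff] at he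
  rcases he with ⟨ha, hb⟩ | ⟨hb, ha⟩
  · rw [eq_comm, LayeredEdge.latticeVertex_eq_src_iff hk _ (by omega) (by omega)] at ha
    obtain ⟨⟨d, i', c⟩, h⟩ := e
    have hs : d.StartsAt k i' := h
    have hi' : i = i' := ha.1
    cases d <;> simp only [StartsAt] at hs
    · omega
    · refine ⟨c, ?_, ?_⟩
      · rw [← hb]; simp [LayeredEdge.tgt, LayeredEdge.row, LayeredEdge.col, LatticeDir.row, LatticeDir.col, ← hi', hi]
      · simp [LayeredEdge.color, LayeredEdge.row, latticeColor, ← hi', hi]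
    · omega
  · rw [eq_comm, LayeredEdge.latticeVertex_eq_tgt_iff hk _ (by omega) (by omega)] at ha
    obtain ⟨⟨d, i', c⟩, h⟩ := e
    have hs : d.StartsAt k i' := h
    have hi' : i = i' + d.row := ha.1
    cases d <;> simp only [StartsAt, LatticeDir.row] at hs hi' <;> omega

/-- The shift by 3 is the row k - 3 of the last ring, reduced modulo k. -/
theorem exists_of_ends_bottom {k : ℕ} (hk : 5 ≤ k) {e : LayeredEdge k} {b : LayeredVertex k} {i : ℤ} {j : ZMod k}
    (hi : i = k - 2) (he : e.ends = s(latticeVertex k i j, b)) :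
    ∃ c : ZMod k, b = latticeVertex k (k - 3) c ∧ e.color = .inl (c - 3) := by
  have h0 := e.row_nonneg
  rw [LayeredEdge.ends, Sym2.eq_iff] at he
  rcases he with ⟨ha, hb⟩ | ⟨hb, ha⟩
  · rw [eq_comm, LayeredEdge.latticeVertex_eq_src_iff hk _ (by omega) (by omega)] at ha
    obtain ⟨⟨d, i', c⟩, h⟩ := e
    have hs : d.StartsAt k i' := h
    have hi' : i = i' := ha.1
    cases d <;> simp only [StartsAt] at hs <;> omega
  · rw [eq_comm, LayeredEdge.latticeVertex_eq_tgt_iff hk _ (by omega) (by omega)] at ha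
    obtain ⟨⟨d, i', c⟩, h⟩ := e
    have hs : d.StartsAt k i' := h
    have hi' : i = i' + d.row := ha.1
    cases d <;> simp only [StartsAt, LatticeDir.row] at hs hi'
    · omega
    · obtain rfl : i' = k - 3 := by omega
      refine ⟨c, ?_, ?_⟩
      · rw [← hb]; simp [LayeredEdge.src]
      · simp [LayeredEdge.color, LayeredEdge.row, latticeColor]; ring
    · omega

/-- Every four-cycle through a pole has two opposite edges of the same color. -/
theorem exists_opposite_color_of_pole {k : ℕ} (hk : 5 ≤ k) {a b c d : LayeredVertex k} {e₁ e₂ e₃ e₄ : LayeredEdge k}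
    (h₁ : e₁.ends = s(a, b)) (h₂ : e₂.ends = s(b, c)) (h₃ : e₃.ends = s(c, d))
    (h₄ : e₄.ends = s(d, a)) (hac : a ≠ c) (hbd : b ≠ d) {i : ℤ} {j : ZMod k}
    (hi : i = 0 ∨ i = k - 2) (ha : a = latticeVertex k i j) :
    e₁.color = e₃.color ∨ e₂.color = e₄.color := by
  rw [Sym2.eq_swap] at h₄
  subst ha
  rcases hi with hi | hi
  · obtain ⟨x, rfl, hx⟩ := exists_of_ends_top hk hi h₁
    obtain ⟨y, rfl, hy⟩ := exists_of_ends_top hk hi h₄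
    obtain ⟨s, rfl, hs1, hs2, hs⟩ := exists_step hk (by omega) (by omega) h₂
    have hrow : 0 ≤ s.row := by
      by_contra hneg
      exact hac ((latticeVertex_eq_iff hk (by omega) (by omega) hs1 hs2).2 ⟨by omega, .inl hi⟩)
    -- The vertex c lies in row 1 or 2, hence on a ring since k ≥ 5, and the next edge is again a
    -- lattice step.
    have hrow' : s.row ≤ 1 := by clear * -; revert s; decide
    obtain ⟨t, hd, ht1, ht2, ht⟩ := exists_step hk (by omega) (by omega) h₃
    rw [latticeVertex_eq_iff hk (by omega) (by omega) ht1 ht2] at hd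
    obtain ⟨hr, hc⟩ := hd
    have hc : y = x + s.col + t.col := by
      rcases hc with hc | hc | hc
      · omega
      · omega
      · exact hc
    have hback : t ≠ s.reverse := by
      rintro rfl
      refine hbd ?_
      rw [hc, LatticeStep.col_reverse]
      simp
    rw [hx, hy, hs, ht]
    clear hs ht hx hy hbd hac h₁ h₂ h₃ h₄
    subst hc
    obtain ⟨s, bs⟩ := s
    obtain ⟨t, bt⟩ := t
    -- If c is in row 1, the path b, c, d is horizontal, and its edge from column x + 1 to x + 2 has
    -- the color x of the opposite pole edge at column x. If c = (2, j), the vertical edge at c and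
    -- the opposite pole edge at column j + 1 both have color j + 1.
    cases s <;> cases bs <;> cases t <;> cases bt <;>
      simp [stepColor, latticeColor, LatticeStep.reverse, LatticeStep.row, LatticeStep.col,
        LatticeDir.row, LatticeDir.col] at * <;> ring_nf at * <;> simp at *
  · obtain ⟨x, rfl, hx⟩ := exists_of_ends_bottom hk hi h₁
    obtain ⟨y, rfl, hy⟩ := exists_of_ends_bottom hk hi h₄
    obtain ⟨s, rfl, hs1, hs2, hs⟩ := exists_step hk (by omega) (by omega) h₂
    have hrow : s.row ≤ 0 := by
      by_contra hneg
      exact hac ((latticeVertex_eq_iff hk (by omega) (by omega) hs1 hs2).2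
        ⟨by omega, .inr (.inl hi)⟩)
    have hrow' : -1 ≤ s.row := by clear * -; revert s; decide
    obtain ⟨t, hd, ht1, ht2, ht⟩ := exists_step hk (by omega) (by omega) h₃
    rw [latticeVertex_eq_iff hk (by omega) (by omega) ht1 ht2] at hd
    obtain ⟨hr, hc⟩ := hd
    have hc : y = x + s.col + t.col := by
      rcases hc with hc | hc | hc
      · omega
      · omega
      · exact hc
    have hback : t ≠ s.reverse := by
      rintro rfl
      refine hbd ?_
      rw [hc, LatticeStep.col_reverse]
      simp
    rw [hx, hy, hs, ht]
    clear hs ht hx hy hbd hac h₁ h₂ h₃ h₄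
    subst hc
    obtain ⟨s, bs⟩ := s
    obtain ⟨t, bt⟩ := t
    -- On the last ring, the horizontal edge from column x to x + 1 has the color x - 1 of the
    -- opposite pole edge at column x + 2. If c = (k - 4, j), the vertical edge at c and the
    -- opposite pole edge at column j - 1 both have color j - 4.
    cases s <;> cases bs <;> cases t <;> cases bt <;>
      simp [stepColor, latticeColor, LatticeStep.reverse, LatticeStep.row, LatticeStep.col,
        LatticeDir.row, LatticeDir.col] at * <;> ring_nf at * <;> simp at *

/-- Every four-cycle of the layered triangulation has two opposite edges of the same color. -/
theorem exists_opposite_color {k : ℕ} (hk : 5 ≤ k) {a b c d : LayeredVertex k} {e₁ e₂ e₃ e₄ : LayeredEdge k}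
    (h₁ : e₁.ends = s(a, b)) (h₂ : e₂.ends = s(b, c)) (h₃ : e₃.ends = s(c, d))
    (h₄ : e₄.ends = s(d, a)) (hac : a ≠ c) (hbd : b ≠ d) :
    e₁.color = e₃.color ∨ e₂.color = e₄.color := by
  obtain ⟨i₁, j₁, h10, h1k, ha⟩ := exists_eq_latticeVertex hk a
  obtain ⟨i₂, j₂, h20, h2k, hb⟩ := exists_eq_latticeVertex hk b
  obtain ⟨i₃, j₃, h30, h3k, hc⟩ := exists_eq_latticeVertex hk c
  obtain ⟨i₄, j₄, h40, h4k, hd⟩ := exists_eq_latticeVertex hk d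
  by_cases p1 : i₁ = 0 ∨ i₁ = k - 2
  · exact exists_opposite_color_of_pole hk h₁ h₂ h₃ h₄ hac hbd p1 ha
  by_cases p2 : i₂ = 0 ∨ i₂ = k - 2
  · exact (exists_opposite_color_of_pole hk h₂ h₃ h₄ h₁ hbd hac.symm p2 hb).symm.imp Eq.symm id
  by_cases p3 : i₃ = 0 ∨ i₃ = k - 2
  · exact (exists_opposite_color_of_pole hk h₃ h₄ h₁ h₂ hac.symm hbd.symm p3 hc).imp
      Eq.symm Eq.symm
  by_cases p4 : i₄ = 0 ∨ i₄ = k - 2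
  · exact (exists_opposite_color_of_pole hk h₄ h₁ h₂ h₃ hbd.symm hac p4 hd).symm.imp id Eq.symm
  rw [not_or] at p1 p2 p3 p4
  subst ha
  obtain ⟨s, hbs, -, -, hs⟩ := exists_step hk (by omega) (by omega) h₁
  subst hb
  obtain ⟨t, hct, -, -, ht⟩ := exists_step hk (by omega) (by omega) h₂
  subst hc
  obtain ⟨u, hdu, -, -, hu⟩ := exists_step hk (by omega) (by omega) h₃
  subst hd
  obtain ⟨v, hav, hv1, hv2, hv⟩ := exists_step hk (by omega) (by omega) h₄
  have hstep : ∀ s : LatticeStep, -1 ≤ s.row ∧ s.row ≤ 1 := by decide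
  have es := hstep s
  have et := hstep t
  have eu := hstep u
  have ev := hstep v
  have hmain : ∀ {i i' : ℤ} {j j' : ZMod k} {s : LatticeStep}, 0 ≤ i → i ≤ k - 2 → ¬ i = 0 →
      ¬ i = k - 2 → 0 ≤ i' → i' ≤ k - 2 → ¬ i' = 0 → ¬ i' = k - 2 →
      latticeVertex k i' j' = latticeVertex k (i + s.row) (j + s.col) →
      i' = i + s.row ∧ j' = j + s.col := by
    intro i i' j j' s _ _ _ _ _ _ _ _ h
    have := hstep s
    rw [latticeVertex_eq_iff hk (by omega) (by omega) (by omega) (by omega)] at h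
    refine ⟨h.1, ?_⟩
    rcases h.2 with h | h | h
    · omega
    · omega
    · exact h
  obtain ⟨r2, c2⟩ := hmain h10 h1k p1.1 p1.2 h20 h2k p2.1 p2.2 hbs
  obtain ⟨r3, c3⟩ := hmain h20 h2k p2.1 p2.2 h30 h3k p3.1 p3.2 hct
  obtain ⟨r4, c4⟩ := hmain h30 h3k p3.1 p3.2 h40 h4k p4.1 p4.2 hdu
  obtain ⟨r1, c1⟩ := hmain h40 h4k p4.1 p4.2 h10 h1k p1.1 p1.2 hav
  -- The total column change vanishes modulo k and has absolute value at most 4 < k, so the cycle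
  -- does not wind around the cylinder.
  have hcol : s.col + t.col + u.col + v.col = 0 := by
    have := s.abs_col_le
    have := t.abs_col_le
    have := u.abs_col_le
    have := v.abs_col_le
    refine eq_zero_of_intCast_zmod (k := k) ?_ (by omega) (by omega)
    rw [c4, c3, c2] at c1
    push_cast
    linear_combination -c1
  have hback : ∀ {i i' i'' : ℤ} {j j' j'' : ZMod k} {s t : LatticeStep},
      latticeVertex k i j ≠ latticeVertex k i'' j'' → i' = i + s.row → j' = j + s.col →
      i'' = i' + t.row → j'' = j' + t.col → t ≠ s.reverse := by
    rintro i i' i'' j j' j'' s t hne hi hj hi' hj' rfl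
    apply hne
    rw [hi', hj', hi, hj, LatticeStep.row_reverse, LatticeStep.col_reverse]
    simp
  obtain ⟨rfl, rfl, hst⟩ := LatticeStep.eq_reverse_of_closed s t u v ⟨by omega, hcol,
    hback hac r2 c2 r3 c3, hback hbd r3 c3 r4 c4, hback hac.symm r4 c4 r1 c1⟩
  have := stepColor_rhombus k s t hst i₁ j₁
  rw [hs, ht, hu, hv]
  rw [LatticeStep.row_reverse] at r4
  rw [LatticeStep.col_reverse] at c4
  have e3 : i₃ = i₁ + s.row + t.row := by omega
  have e4 : i₄ = i₁ + t.row := by omega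
  have f3 : j₃ = j₁ + s.col + t.col := by rw [c3, c2]
  have f4 : j₄ = j₁ + t.col := by rw [c4, c3, c2]; push_cast; ring
  rwa [r2, c2, e3, f3, e4, f4]

/-! ### The layered triangulation as a graph -/

/-- The triangulation with two poles and `k - 3` rings of `k` vertices. -/
def layeredGraph (k : ℕ) : SimpleGraph (LayeredVertex k) :=
  fromEdgeSet (Set.range LayeredEdge.ends)

theorem LayeredEdge.src_ne_tgt {k : ℕ} (hk : 5 ≤ k) (e : LayeredEdge k) : e.src ≠ e.tgt := by
  intro h
  have h0 := e.row_nonneg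
  have h1 := e.row_add_le
  have h2 := dir_row_nonneg e.dir
  rw [show e.src = latticeVertex k e.row e.col from rfl,
    latticeVertex_eq_tgt_iff hk _ h0 (by omega)] at h
  have hone : ((1 : ℤ) : ZMod k) ≠ 0 := fun h => by
    have := eq_zero_of_intCast_zmod h (by omega) (by omega); omega
  have hsucc : ∀ j : ZMod k, j ≠ j + 1 := fun j h => hone (by simpa using h)
  obtain ⟨⟨d, i, j⟩, hs'⟩ := e
  have hs : d.StartsAt k i := hs'
  cases d <;> simp only [StartsAt, LayeredEdge.row, LayeredEdge.col, LatticeDir.row,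
    LatticeDir.col] at * <;> push_cast at * <;> grind

theorem LayeredEdge.ends_mem {k : ℕ} (hk : 5 ≤ k) (e : LayeredEdge k) :
    e.ends ∈ (layeredGraph k).edgeSet := by
  rw [layeredGraph, edgeSet_fromEdgeSet]
  exact ⟨⟨e, rfl⟩, fun h => e.src_ne_tgt hk h⟩

theorem exists_layeredEdge {k : ℕ} (e : (layeredGraph k).edgeSet) :
    ∃ x : LayeredEdge k, x.ends = e := by
  obtain ⟨e, he⟩ := e
  rw [layeredGraph, edgeSet_fromEdgeSet] at he
  exact he.1

open Classical in
theorem le_card_edgeFinset_layeredGraph {k : ℕ} [NeZero k] (hk : 5 ≤ k) :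
    3 * (k ^ 2 - 3 * k + 2) - 6 ≤ (layeredGraph k).edgeFinset.card := by
  -- The three directions contribute k(k - 3) + k(k - 2) + k(k - 4) = 3k² - 9k edges, which is 3n -
  -- 6.
  let F : Fin (k - 3) × ZMod k ⊕ Fin (k - 2) × ZMod k ⊕ Fin (k - 4) × ZMod k → LayeredEdge k
    | .inl (i, j) => ⟨(horizontal, i + 1, j), by simp only [StartsAt]; omega⟩
    | .inr (.inl (i, j)) => ⟨(vertical, i, j), by simp only [StartsAt]; omega⟩
    | .inr (.inr (i, j)) => ⟨(diagonal, i + 1, j), by simp only [StartsAt]; omega⟩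
  have hF : Function.Injective F := by
    rintro (⟨i, j⟩ | ⟨i, j⟩ | ⟨i, j⟩) (⟨i', j'⟩ | ⟨i', j'⟩ | ⟨i', j'⟩) h <;>
      simp [F, Fin.ext_iff] at h ⊢ <;> exact h
  have hG : Function.Injective
      fun x => (⟨(F x).ends, (F x).ends_mem hk⟩ : (layeredGraph k).edgeSet) := fun x y h =>
    hF (LayeredEdge.ends_injective hk (Subtype.ext_iff.1 h))
  have hcard := Fintype.card_le_of_injective _ hG
  rw [← edgeFinset_card] at hcard
  refine le_trans ?_ hcard
  simp only [Fintype.card_sum, Fintype.card_prod, Fintype.card_fin, ZMod.card]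
  obtain ⟨m, rfl⟩ := Nat.exists_eq_add_of_le' hk
  rw [show (m + 5) ^ 2 - 3 * (m + 5) = m * m + 7 * m + 10 by
      rw [Nat.sub_eq_iff_eq_add (by nlinarith)]; ring,
    show m + 5 - 3 = m + 2 by omega, show m + 5 - 2 = m + 3 by omega,
    show m + 5 - 4 = m + 1 by omega]
  apply le_of_eq
  rw [Nat.sub_eq_iff_eq_add (by nlinarith)]
  ring

theorem card_layeredVertex {k : ℕ} [NeZero k] (hk : 5 ≤ k) :
    Fintype.card (LayeredVertex k) = k ^ 2 - 3 * k + 2 := by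
  simp only [Fintype.card_sum, Fintype.card_prod, Fintype.card_fin, ZMod.card, Fintype.card_bool]
  obtain ⟨m, rfl⟩ := Nat.exists_eq_add_of_le' hk
  rw [show (m + 5) ^ 2 - 3 * (m + 5) = m * m + 7 * m + 10 by
      rw [Nat.sub_eq_iff_eq_add (by nlinarith)]; ring, show m + 5 - 3 = m + 2 by omega]
  ring

theorem layeredGraph_hasRainbowFreeColoring {k : ℕ} [NeZero k] (hk : 5 ≤ k) :
    (layeredGraph k).HasRainbowFreeColoring (cycleGraph 4) := by
  choose x hx using exists_layeredEdge (k := k)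
  obtain ⟨ι, hι⟩ := exists_injective_nat (ZMod k ⊕ ZMod 2)
  refine ⟨Coloring.mk (fun e => ι (x e).color) ?_, fun f hf => ?_⟩
  · intro e e' hadj heq
    obtain ⟨hne, v, hv, hv'⟩ := lineGraph_adj_iff_exists.1 hadj
    rw [← hx] at hv hv'
    have := LayeredEdge.eq_of_color_eq hk hv hv' (hι heq)
    exact hne (Subtype.ext (by rw [← hx, ← hx, this]))
  · have hadj : ∀ i : Fin 4, (cycleGraph 4).Adj i (i + 1) := by decide
    let E (i : Fin 4) : (cycleGraph 4).edgeSet := ⟨s(i, i + 1), hadj i⟩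
    have hE : ∀ i, (x (f.mapEdgeSet (E i))).ends = s(f i, f (i + 1)) := fun i => hx _
    have hne : ∀ {i j : Fin 4}, s(i, i + 1) ≠ s(j, j + 1) →
        (x (f.mapEdgeSet (E i))).color ≠ (x (f.mapEdgeSet (E j))).color := fun hij h =>
      hij (Subtype.ext_iff.1 (hf (congrArg ι h)))
    rcases exists_opposite_color hk (hE 0) (hE 1) (hE 2) (hE 3)
      (f.injective.ne (by decide)) (f.injective.ne (by decide)) with h | h
    · exact hne (by decide) h
    · exact hne (by decide) h

/-! ### Transport along isomorphisms -/

section Iso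

variable {V V' W : Type*} {G : SimpleGraph V} {G' : SimpleGraph V'} {H : SimpleGraph W}

theorem IsPlanar.of_iso (hG : G.IsPlanar) (f : G' ≃g G) : G'.IsPlanar := by
  obtain ⟨E⟩ := hG
  have hmem : ∀ (e : G'.edgeSet) (v : V'), f v ∈ (f.mapEdgeSet e : Sym2 V) ↔ v ∈ (e : Sym2 V') := by
    intro e v
    change f v ∈ Sym2.map f e ↔ _
    rw [Sym2.mem_map]
    exact ⟨fun ⟨a, ha, h⟩ => f.injective h ▸ ha, fun h => ⟨v, h, rfl⟩⟩
  refine ⟨⟨fun v => E.point (f v), fun e => E.arc (f.mapEdgeSet e),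
    E.point_injective.comp f.injective, fun e => E.arc_continuous _, fun e => E.arc_injective _,
    fun e => ?_, fun e v h => (hmem e v).1 (E.mem_of_point_mem_arc _ _ h), fun e e' hne => ?_⟩⟩
  · rw [E.arc_ends]
    ext z
    constructor
    · rintro ⟨v, hv, rfl⟩
      obtain ⟨v, rfl⟩ := f.surjective v
      exact ⟨v, (hmem e v).1 hv, rfl⟩
    · rintro ⟨v, hv, rfl⟩
      exact ⟨f v, (hmem e v).2 hv, rfl⟩
  · refine (E.arc_inter_subset _ _ (f.mapEdgeSet.injective.ne hne)).trans ?_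
    rintro _ ⟨v, rfl⟩
    obtain ⟨v, rfl⟩ := f.surjective v
    exact ⟨v, rfl⟩

theorem HasRainbowFreeColoring.of_iso (hG : G.HasRainbowFreeColoring H) (f : G' ≃g G) :
    G'.HasRainbowFreeColoring H := by
  obtain ⟨c, hc⟩ := hG
  refine ⟨c.comp f.lineGraph.toHom, fun φ hφ => hc (f.toCopy.comp φ) fun e e' h => hφ ?_⟩
  have key : ∀ e : H.edgeSet,
      (f.toCopy.comp φ).mapEdgeSet e = f.lineGraph (φ.mapEdgeSet e) := by
    rintro ⟨e, he⟩
    apply Subtype.ext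
    induction e with
    | _ a b => rfl
  simp only [key] at h
  exact h

open Classical in
theorem card_edgeFinset_le_rainbowPlanarTuranNumber [Fintype V] (hG : G.IsPlanar)
    (hH : G.HasRainbowFreeColoring H) :
    G.edgeFinset.card ≤ rainbowPlanarTuranNumber (Fintype.card V) H := by
  let f := Iso.map (Fintype.equivFin V) G
  rw [f.card_edgeFinset_eq, rainbowPlanarTuranNumber]
  refine le_of_eq_of_le ?_ (Finset.le_sup (b := G.map (Fintype.equivFin V))
    (Finset.mem_filter.2 ⟨Finset.mem_univ _, hG.of_iso f.symm, hH.of_iso f.symm⟩))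
  congr!

end Iso

/-! ### A drawing of the layered triangulation -/

/-- The point of the unit circle that corresponds to a column. -/
noncomputable def columnPoint (k : ℕ) (y : ℝ) : ℂ :=
  Complex.exp ((2 * Real.pi * y / k : ℝ) * Complex.I)

theorem norm_columnPoint (k : ℕ) (y : ℝ) : ‖columnPoint k y‖ = 1 :=
  Complex.norm_exp_ofReal_mul_I _

theorem continuous_columnPoint (k : ℕ) : Continuous (columnPoint k) := by
  unfold columnPoint
  fun_prop

theorem columnPoint_eq_iff {k : ℕ} (hk : 5 ≤ k) {y y' : ℝ} :
    columnPoint k y = columnPoint k y' ↔ ∃ z : ℤ, y = y' + z * k := by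
  have hk0 : (k : ℝ) ≠ 0 := by positivity
  rw [columnPoint, columnPoint, Complex.exp_eq_exp_iff_exists_int]
  refine exists_congr fun z => ?_
  rw [show (2 * Real.pi * y' / k : ℝ) * Complex.I + z * (2 * Real.pi * Complex.I) =
      (2 * Real.pi * y' / k + z * (2 * Real.pi) : ℝ) * Complex.I by push_cast; ring,
    mul_left_inj' Complex.I_ne_zero, Complex.ofReal_inj]
  have hpi := Real.pi_ne_zero
  field_simp

/-- The cylinder coordinates `x ∈ [0, k - 2]` and `y` modulo `k` of a point of the sphere with
poles `x = 0` and `x = k - 2` are determined by its projective coordinates. -/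
theorem coordinates_eq {k : ℕ} (hk : 5 ≤ k) {x x' y y' : ℝ} (hx : 0 ≤ x) (hxk : x ≤ k - 2)
    (hx' : 0 ≤ x') (hxk' : x' ≤ k - 2)
    (h : ((k - 2 - x' : ℝ) : ℂ) * x * columnPoint k y = ((k - 2 - x : ℝ) : ℂ) * x' * columnPoint k y') :
    x = x' ∧ (x = 0 ∨ x = k - 2 ∨ ∃ z : ℤ, y = y' + z * k) := by
  have hk2 : (0 : ℝ) < k - 2 := by
    have : (5 : ℝ) ≤ k := by exact_mod_cast hk
    linarith
  -- Norms remove the angles and leave (k - 2 - x') x = (k - 2 - x) x', which forces x = x'.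
  have hn := congrArg norm h
  rw [norm_mul, norm_mul, norm_mul, norm_mul, norm_columnPoint, norm_columnPoint,
    Complex.norm_of_nonneg (by linarith), Complex.norm_of_nonneg hx,
    Complex.norm_of_nonneg (by linarith), Complex.norm_of_nonneg hx'] at hn
  have hxx : x = x' := mul_left_cancel₀ hk2.ne' (by linarith)
  subst hxx
  refine ⟨rfl, ?_⟩
  by_cases h0 : x = 0
  · exact .inl h0
  by_cases h1 : x = k - 2
  · exact .inr (.inl h1)
  refine .inr (.inr ((columnPoint_eq_iff hk).1 (mul_left_cancel₀ (mul_ne_zero ?_ ?_) h)))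
  · exact_mod_cast sub_ne_zero.2 (Ne.symm h1)
  · exact_mod_cast h0

/-- The point `(1/2, 1/2)` of the cylinder in the affine chart of the sphere around the pole
`x = 0`. -/
noncomputable def basePoint (k : ℕ) : ℂ := columnPoint k (1 / 2) * (1 / 2) / (k - 2 - 1 / 2)

/-- The denominator of `layeredPoint`. -/
noncomputable def layeredDenom (k : ℕ) (x y : ℝ) : ℂ :=
  x * columnPoint k y - (k - 2 - x : ℝ) * basePoint k

/-- The image of a point of the cylinder under a Möbius transformation that sends `(1/2, 1/2)` to
infinity. -/
noncomputable def layeredPoint (k : ℕ) (x y : ℝ) : ℂ := (k - 2 - x : ℝ) / layeredDenom k x y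

theorem layeredDenom_ne_zero {k : ℕ} (hk : 5 ≤ k) {x y : ℝ} (hx : 0 ≤ x) (hxk : x ≤ k - 2)
    (h : ∀ z : ℤ, x = 1 / 2 → y ≠ 1 / 2 + z * k) : layeredDenom k x y ≠ 0 := by
  have hk5 : (5 : ℝ) ≤ k := by exact_mod_cast hk
  intro h0
  have hne : (k - 2 - 1 / 2 : ℂ) ≠ 0 := by
    have : ((k - 2 - 1 / 2 : ℝ) : ℂ) ≠ 0 := Complex.ofReal_ne_zero.2 (by linarith)
    push_cast at this
    exact this
  have := coordinates_eq hk hx hxk (x' := 1 / 2) (y := y) (y' := 1 / 2) (by norm_num) (by linarith)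
    (by
      rw [layeredDenom, sub_eq_zero, basePoint] at h0
      push_cast at h0 ⊢
      rw [mul_assoc, h0]
      generalize (k - 2 - 1 / 2 : ℂ) = D at hne
      field_simp)
  obtain ⟨hx2, h1 | h1 | ⟨z, hz⟩⟩ := this
  · linarith
  · linarith
  · exact h z hx2 hz

theorem layeredPoint_injective {k : ℕ} (hk : 5 ≤ k) {x x' y y' : ℝ} (hx : 0 ≤ x) (hxk : x ≤ k - 2)
    (hx' : 0 ≤ x') (hxk' : x' ≤ k - 2) (hd : layeredDenom k x y ≠ 0)
    (hd' : layeredDenom k x' y' ≠ 0) (h : layeredPoint k x y = layeredPoint k x' y') :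
    x = x' ∧ (x = 0 ∨ x = k - 2 ∨ ∃ z : ℤ, y = y' + z * k) := by
  apply coordinates_eq hk hx hxk hx' hxk'
  rw [layeredPoint, layeredPoint, div_eq_div_iff hd hd', layeredDenom, layeredDenom] at h
  linear_combination -h

theorem layeredPoint_zero (k : ℕ) (y y' : ℝ) : layeredPoint k 0 y = layeredPoint k 0 y' := by
  simp [layeredPoint, layeredDenom]

theorem layeredPoint_top (k : ℕ) (y y' : ℝ) :
    layeredPoint k (k - 2) y = layeredPoint k (k - 2) y' := by
  simp [layeredPoint]

/-- The position of a vertex. -/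
noncomputable def vertexPoint (k : ℕ) : LayeredVertex k → ℂ
  | .inl false => layeredPoint k 0 0
  | .inl true => layeredPoint k (k - 2) 0
  | .inr (i, j) => layeredPoint k (i + 1) j.val

/-- Any integer lift of the column is allowed, because the lift reached at the end of an edge need
not be reduced modulo k. -/
theorem vertexPoint_latticeVertex {k : ℕ} (hk : 5 ≤ k) {i : ℤ} {j : ZMod k} (hi : 0 ≤ i)
    (hik : i ≤ k - 2) {y : ℤ} (hy : (y : ZMod k) = j) :
    vertexPoint k (latticeVertex k i j) = layeredPoint k i y := by
  have : NeZero k := ⟨by omega⟩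
  unfold latticeVertex
  split_ifs with h0 h1
  · obtain rfl : i = 0 := by omega
    simpa [vertexPoint] using layeredPoint_zero k 0 y
  · have hrow : (((i - 1).toNat : ℝ) + 1) = i := by
      have : (((i - 1).toNat : ℤ) : ℝ) = ((i - 1 : ℤ) : ℝ) := by congr 1; omega
      push_cast at this
      linarith
    obtain ⟨z, hz⟩ : (k : ℤ) ∣ j.val - y := by
      rw [← ZMod.intCast_zmod_eq_zero_iff_dvd]
      simp [hy]
    have hcol : columnPoint k j.val = columnPoint k y := by
      refine (columnPoint_eq_iff hk).2 ⟨z, ?_⟩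
      have : ((j.val - y : ℤ) : ℝ) = ((k * z : ℤ) : ℝ) := by rw [hz]
      push_cast at this
      linarith
    simp only [vertexPoint]
    rw [hrow, layeredPoint, layeredPoint, layeredDenom, layeredDenom, hcol]
  · obtain rfl : i = k - 2 := by omega
    push_cast
    exact layeredPoint_top k 0 y

theorem layeredDenom_int_ne_zero {k : ℕ} (hk : 5 ≤ k) {i : ℤ} (hi : 0 ≤ i) (hik : i ≤ k - 2)
    (y : ℝ) : layeredDenom k i y ≠ 0 := by
  refine layeredDenom_ne_zero hk (by exact_mod_cast hi) (by exact_mod_cast hik) fun z h => ?_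
  have : ((2 * i : ℤ) : ℝ) = ((1 : ℤ) : ℝ) := by push_cast; linarith
  have : 2 * i = 1 := by exact_mod_cast this
  omega

theorem vertexPoint_injective {k : ℕ} (hk : 5 ≤ k) : Function.Injective (vertexPoint k) := by
  have : NeZero k := ⟨by omega⟩
  intro a b hab
  obtain ⟨i, j, hi, hik, rfl⟩ := exists_eq_latticeVertex hk a
  obtain ⟨i', j', hi', hik', rfl⟩ := exists_eq_latticeVertex hk b
  rw [vertexPoint_latticeVertex hk hi hik (y := j.val) (by simp),
    vertexPoint_latticeVertex hk hi' hik' (y := j'.val) (by simp)] at hab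
  have := layeredPoint_injective hk (by exact_mod_cast hi) (by exact_mod_cast hik)
    (by exact_mod_cast hi') (by exact_mod_cast hik') (layeredDenom_int_ne_zero hk hi hik _)
    (layeredDenom_int_ne_zero hk hi' hik' _) hab
  rw [latticeVertex_eq_iff hk hi hik hi' hik']
  refine ⟨by exact_mod_cast this.1, ?_⟩
  rcases this.2 with h | h | ⟨z, hz⟩
  · exact .inl (by exact_mod_cast h)
  · exact .inr (.inl (by exact_mod_cast h))
  · refine .inr (.inr ?_)
    have h : (j.val : ℤ) = j'.val + z * k := by exact_mod_cast hz
    have := congrArg (Int.cast : ℤ → ZMod k) h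
    simpa using this

namespace LayeredEdge

variable {k : ℕ}

/-- The row coordinate at parameter `s` of an edge. -/
noncomputable def xCoord (e : LayeredEdge k) (s : ℝ) : ℝ := e.row + s * e.dir.row

/-- The column coordinate at parameter `s` of an edge. -/
noncomputable def yCoord (e : LayeredEdge k) (s : ℝ) : ℝ := e.col.val + s * e.dir.col

/-- The point at parameter `s` of the arc of an edge. -/
noncomputable def arcPoint (e : LayeredEdge k) (s : ℝ) : ℂ :=
  layeredPoint k (e.xCoord s) (e.yCoord s)

theorem xCoord_nonneg (e : LayeredEdge k) {s : ℝ} (hs : 0 ≤ s) : 0 ≤ e.xCoord s := by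
  have h1 : (0 : ℝ) ≤ e.row := by exact_mod_cast e.row_nonneg
  have h2 : (0 : ℝ) ≤ e.dir.row := by exact_mod_cast dir_row_nonneg e.dir
  unfold xCoord
  positivity

theorem xCoord_le (e : LayeredEdge k) {s : ℝ} (hs : s ≤ 1) : e.xCoord s ≤ k - 2 := by
  have h1 : (e.row + e.dir.row : ℝ) ≤ k - 2 := by exact_mod_cast e.row_add_le
  have h2 : (0 : ℝ) ≤ e.dir.row := by exact_mod_cast dir_row_nonneg e.dir
  unfold xCoord
  nlinarith

/-- No edge meets the point (1/2, 1/2) sent to infinity: horizontal edges have integral rows,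
vertical ones integral columns, and diagonals start at row 1 or later. -/
theorem layeredDenom_coord_ne_zero (hk : 5 ≤ k) (e : LayeredEdge k) {s : ℝ} (hs : 0 ≤ s)
    (hs1 : s ≤ 1) : layeredDenom k (e.xCoord s) (e.yCoord s) ≠ 0 := by
  refine layeredDenom_ne_zero hk (e.xCoord_nonneg hs) (e.xCoord_le hs1) fun z hx hy => ?_
  obtain ⟨⟨d, i, j⟩, h'⟩ := e
  have h : d.StartsAt k i := h'
  cases d <;> simp only [StartsAt, xCoord, yCoord, LayeredEdge.row, LayeredEdge.col,
    LatticeDir.row, LatticeDir.col] at h hx hy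
  · have : ((2 * i : ℤ) : ℝ) = ((1 : ℤ) : ℝ) := by push_cast at *; linarith
    have : 2 * i = 1 := by exact_mod_cast this
    omega
  · have : ((2 * j.val : ℤ) : ℝ) = ((1 + 2 * (z * k) : ℤ) : ℝ) := by push_cast at *; linarith
    have : 2 * (j.val : ℤ) = 1 + 2 * (z * k) := by exact_mod_cast this
    omega
  · have : (1 : ℝ) ≤ i := by exact_mod_cast h.1
    push_cast at *
    linarith

theorem arcPoint_zero (hk : 5 ≤ k) (e : LayeredEdge k) : e.arcPoint 0 = vertexPoint k e.src := by
  have : NeZero k := ⟨by omega⟩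
  have h1 := e.row_add_le
  have h2 := dir_row_nonneg e.dir
  rw [src, vertexPoint_latticeVertex hk e.row_nonneg (by omega) (y := e.col.val) (by simp)]
  simp [arcPoint, xCoord, yCoord]

theorem arcPoint_one (hk : 5 ≤ k) (e : LayeredEdge k) : e.arcPoint 1 = vertexPoint k e.tgt := by
  have : NeZero k := ⟨by omega⟩
  have h1 := e.row_nonneg
  have h2 := dir_row_nonneg e.dir
  rw [tgt, vertexPoint_latticeVertex hk (by omega) e.row_add_le
    (y := e.col.val + e.dir.col) (by simp)]
  simp [arcPoint, xCoord, yCoord]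

theorem add_fract_inj {m n : ℤ} {s t : ℝ} (hs : 0 < s) (hs1 : s < 1) (ht : 0 ≤ t) (ht1 : t < 1)
    (h : m + s = n + t) : m = n ∧ s = t := by
  have h1 : ((m - n : ℤ) : ℝ) < (1 : ℤ) := by push_cast; linarith
  have h2 : ((-1 : ℤ) : ℝ) < (m - n : ℤ) := by push_cast; linarith
  have h3 : m - n < 1 := by exact_mod_cast h1
  have h4 : -1 < m - n := by exact_mod_cast h2
  obtain rfl : m = n := by omega
  exact ⟨rfl, by linarith⟩

theorem interior_ne_pole (e : LayeredEdge k) {s : ℝ} (hs : 0 < s) (hs1 : s < 1) :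
    e.xCoord s ≠ 0 ∧ e.xCoord s ≠ k - 2 := by
  obtain ⟨⟨d, i, j⟩, h'⟩ := e
  have h : d.StartsAt k i := h'
  cases d <;> simp only [StartsAt, xCoord, LayeredEdge.row, LatticeDir.row] at h ⊢
  all_goals
    obtain ⟨h1, h2⟩ := h
    have h1' : ((_ : ℤ) : ℝ) ≤ i := Int.cast_le.2 h1
    have h2' : (i : ℝ) ≤ _ := Int.cast_le.2 h2
    push_cast at *
    constructor <;> intro h <;> linarith

theorem arcPoint_ne_vertexPoint (hk : 5 ≤ k) (e : LayeredEdge k) {s : ℝ} (hs : 0 < s)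
    (hs1 : s < 1) (v : LayeredVertex k) : e.arcPoint s ≠ vertexPoint k v := by
  have : NeZero k := ⟨by omega⟩
  intro heq
  obtain ⟨r, c, hr, hrk, rfl⟩ := exists_eq_latticeVertex hk v
  rw [vertexPoint_latticeVertex hk hr hrk (y := c.val) (by simp)] at heq
  obtain ⟨hx, hy⟩ := layeredPoint_injective hk (e.xCoord_nonneg hs.le) (e.xCoord_le hs1.le)
    (by exact_mod_cast hr) (by exact_mod_cast hrk) (e.layeredDenom_coord_ne_zero hk hs.le hs1.le)
    (layeredDenom_int_ne_zero hk hr hrk _) heq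
  obtain ⟨z, hz⟩ := (hy.resolve_left (e.interior_ne_pole hs hs1).1).resolve_left
    (e.interior_ne_pole hs hs1).2
  obtain ⟨⟨d, i, j⟩, h'⟩ := e
  cases d <;> simp only [xCoord, yCoord, LayeredEdge.row, LayeredEdge.col, LatticeDir.row,
    LatticeDir.col] at hx hz
  · have := (add_fract_inj (m := j.val) (n := c.val + z * k) hs hs1 le_rfl one_pos (by
      push_cast at *; linarith)).2
    linarith
  · have := (add_fract_inj (m := i) (n := r) hs hs1 le_rfl one_pos (by
      push_cast at *; linarith)).2
    linarith
  · have := (add_fract_inj (m := i) (n := r) hs hs1 le_rfl one_pos (by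
      push_cast at *; linarith)).2
    linarith

/-- Integrality separates the directions: in the interior of an edge only the row is integral
(horizontal), only the column (vertical), or neither (diagonal). Within one direction, integer and
fractional parts recover the edge and the parameter. -/
theorem arcPoint_injective_interior (hk : 5 ≤ k) {e f : LayeredEdge k} {s t : ℝ} (hs : 0 < s)
    (hs1 : s < 1) (ht : 0 < t) (ht1 : t < 1) (heq : e.arcPoint s = f.arcPoint t) :
    e = f ∧ s = t := by
  have : NeZero k := ⟨by omega⟩
  obtain ⟨hx, hy⟩ := layeredPoint_injective hk (e.xCoord_nonneg hs.le) (e.xCoord_le hs1.le)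
    (f.xCoord_nonneg ht.le) (f.xCoord_le ht1.le) (e.layeredDenom_coord_ne_zero hk hs.le hs1.le)
    (f.layeredDenom_coord_ne_zero hk ht.le ht1.le) heq
  obtain ⟨z, hz⟩ := (hy.resolve_left (e.interior_ne_pole hs hs1).1).resolve_left
    (e.interior_ne_pole hs hs1).2
  have hcol : ∀ {j j' : ZMod k}, (j.val : ℤ) = j'.val + z * k → j = j' := by
    intro j j' h
    have := congrArg (Int.cast : ℤ → ZMod k) h
    simpa using this
  obtain ⟨⟨d, i, j⟩, h⟩ := e
  obtain ⟨⟨d', i', j'⟩, h'⟩ := f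
  simp only [Subtype.mk.injEq, Prod.mk.injEq]
  cases d <;> cases d' <;> simp only [xCoord, yCoord, LayeredEdge.row, LayeredEdge.col,
    LatticeDir.row, LatticeDir.col] at hx hz <;> push_cast at hx hz
  · obtain ⟨h1, h2⟩ := add_fract_inj (m := j.val) (n := j'.val + z * k) hs hs1 ht.le ht1 (by
      push_cast; linarith)
    have h3 : (i : ℝ) = i' := by linarith
    exact ⟨⟨rfl, by exact_mod_cast h3, hcol h1⟩, h2⟩
  · have := (add_fract_inj (m := i') (n := i) ht ht1 le_rfl one_pos (by linarith)).2
    linarith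
  · have := (add_fract_inj (m := i') (n := i) ht ht1 le_rfl one_pos (by linarith)).2
    linarith
  · have := (add_fract_inj (m := i) (n := i') hs hs1 le_rfl one_pos (by linarith)).2
    linarith
  · obtain ⟨h1, h2⟩ := add_fract_inj (m := i) (n := i') hs hs1 ht.le ht1 (by linarith)
    have h3 : ((j.val : ℤ) : ℝ) = ((j'.val + z * k : ℤ) : ℝ) := by push_cast; linarith
    exact ⟨⟨rfl, h1, hcol (by exact_mod_cast h3)⟩, h2⟩
  · have := (add_fract_inj (m := j.val) (n := j'.val + z * k) ht ht1 le_rfl one_pos (by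
      push_cast; linarith)).2
    linarith
  · have := (add_fract_inj (m := i) (n := i') hs hs1 le_rfl one_pos (by linarith)).2
    linarith
  · have := (add_fract_inj (m := j'.val + z * k) (n := j.val) hs hs1 le_rfl one_pos (by
      push_cast; linarith)).2
    linarith
  · obtain ⟨h1, h2⟩ := add_fract_inj (m := i) (n := i') hs hs1 ht.le ht1 (by linarith)
    have h3 : ((j.val : ℤ) : ℝ) = ((j'.val + z * k : ℤ) : ℝ) := by push_cast; linarith
    exact ⟨⟨rfl, h1, hcol (by exact_mod_cast h3)⟩, h2⟩

theorem arcPoint_eq_vertexPoint (hk : 5 ≤ k) (e : LayeredEdge k) {s : ℝ} (hs : 0 ≤ s)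
    (hs1 : s ≤ 1) {v : LayeredVertex k} (h : vertexPoint k v = e.arcPoint s) :
    (s = 0 ∧ v = e.src) ∨ (s = 1 ∧ v = e.tgt) := by
  rcases hs.eq_or_lt with rfl | hs
  · exact .inl ⟨rfl, vertexPoint_injective hk (h.trans (e.arcPoint_zero hk))⟩
  rcases hs1.eq_or_lt with rfl | hs1
  · exact .inr ⟨rfl, vertexPoint_injective hk (h.trans (e.arcPoint_one hk))⟩
  exact absurd h.symm (e.arcPoint_ne_vertexPoint hk hs hs1 v)

theorem continuous_arcPoint (hk : 5 ≤ k) (e : LayeredEdge k) :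
    Continuous fun s : unitInterval => e.arcPoint s := by
  have hx : Continuous fun s : unitInterval => e.xCoord s := by unfold xCoord; fun_prop
  have hy : Continuous fun s : unitInterval => e.yCoord s := by unfold yCoord; fun_prop
  have hc := (continuous_columnPoint k).comp hy
  refine Continuous.div (by fun_prop) ?_ fun s => e.layeredDenom_coord_ne_zero hk s.2.1 s.2.2
  unfold layeredDenom
  exact ((Complex.continuous_ofReal.comp hx).mul hc).sub (by fun_prop)

theorem arcPoint_eq_vertexPoint_or_interior (hk : 5 ≤ k) (e : LayeredEdge k) {s : ℝ} (hs : 0 ≤ s)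
    (hs1 : s ≤ 1) : (∃ v ∈ e.ends, e.arcPoint s = vertexPoint k v) ∨ (0 < s ∧ s < 1) := by
  rcases hs.eq_or_lt with rfl | hs
  · exact .inl ⟨e.src, by simp [ends], e.arcPoint_zero hk⟩
  rcases hs1.eq_or_lt with rfl | hs1
  · exact .inl ⟨e.tgt, by simp [ends], e.arcPoint_one hk⟩
  exact .inr ⟨hs, hs1⟩

end LayeredEdge

theorem layeredGraph_isPlanar {k : ℕ} (hk : 5 ≤ k) : (layeredGraph k).IsPlanar := by
  choose x hx using exists_layeredEdge (k := k)
  let ψ := Complex.equivRealProdCLM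
  have hψ : Function.Injective ψ := ψ.injective
  refine ⟨⟨fun v => ψ (vertexPoint k v), fun e s => ψ ((x e).arcPoint s),
    hψ.comp (vertexPoint_injective hk), fun e =>
    ψ.continuous.comp ((x e).continuous_arcPoint hk), ?_, ?_, ?_, ?_⟩⟩
  · intro e s t hst
    replace hst := hψ hst
    rcases (x e).arcPoint_eq_vertexPoint_or_interior hk s.2.1 s.2.2 with ⟨v, -, hv⟩ | hs
    · have h1 := (x e).arcPoint_eq_vertexPoint hk s.2.1 s.2.2 hv.symm
      have h2 := (x e).arcPoint_eq_vertexPoint hk t.2.1 t.2.2 (hv.symm.trans hst)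
      have h3 := (x e).src_ne_tgt hk
      apply Subtype.ext
      grind
    · rcases (x e).arcPoint_eq_vertexPoint_or_interior hk t.2.1 t.2.2 with ⟨v, -, hv⟩ | ht
      · exact absurd (hst.trans hv) ((x e).arcPoint_ne_vertexPoint hk hs.1 hs.2 v)
      · exact Subtype.ext (LayeredEdge.arcPoint_injective_interior hk hs.1 hs.2 ht.1 ht.2 hst).2
  · intro e
    have h0 := (x e).arcPoint_zero hk
    have h1 := (x e).arcPoint_one hk
    simp only [Set.Icc.coe_zero, Set.Icc.coe_one, h0, h1, ← hx e, LayeredEdge.ends]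
    ext z
    simp [eq_comm]
  · rintro e v ⟨s, hs⟩
    rw [← hx e, LayeredEdge.ends, Sym2.mem_iff]
    exact ((x e).arcPoint_eq_vertexPoint hk s.2.1 s.2.2 (hψ hs).symm).imp And.right And.right
  · rintro e f hef _ ⟨⟨s, rfl⟩, ⟨t, ht⟩⟩
    rcases (x e).arcPoint_eq_vertexPoint_or_interior hk s.2.1 s.2.2 with ⟨v, -, hv⟩ | hs
    · exact ⟨v, by simp only [hv]⟩
    rcases (x f).arcPoint_eq_vertexPoint_or_interior hk t.2.1 t.2.2 with ⟨v, -, hv⟩ | ht'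
    · exact ⟨v, by rw [← ht]; simp only [hv]⟩
    · have := (LayeredEdge.arcPoint_injective_interior hk hs.1 hs.2 ht'.1 ht'.2 (hψ ht).symm).1
      exact absurd (Subtype.ext (by rw [← hx e, ← hx f, this])) hef

end SimpleGraph

/-! ### The upper and lower bounds combined -/

theorem theorem1p1 (k n : ℕ) (hk : 5 ≤ k) (hn : n = k ^ 2 - 3 * k + 2) :
    SimpleGraph.rainbowPlanarTuranNumber n (SimpleGraph.cycleGraph 4) = 3 * n - 6 := by
  classical
  have : NeZero k := ⟨by omega⟩
  have hcard := SimpleGraph.card_layeredVertex hk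
  have h5 : 3 ≤ k ^ 2 - 3 * k + 2 := by
    obtain ⟨m, rfl⟩ := Nat.exists_eq_add_of_le' hk
    rw [show (m + 5) ^ 2 - 3 * (m + 5) = m * m + 7 * m + 10 by
      rw [Nat.sub_eq_iff_eq_add (by nlinarith)]; ring]
    omega
  subst hn
  apply le_antisymm
  · refine Finset.sup_le fun G hG => ?_
    have := (Finset.mem_filter.1 hG).2.1.card_edgeFinset_le (by rwa [Fintype.card_fin])
    rw [Fintype.card_fin] at this
    convert this
  · refine (SimpleGraph.le_card_edgeFinset_layeredGraph hk).trans ?_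
    have := SimpleGraph.card_edgeFinset_le_rainbowPlanarTuranNumber
      (SimpleGraph.layeredGraph_isPlanar hk) (SimpleGraph.layeredGraph_hasRainbowFreeColoring hk)
    rw [hcard] at this
    convert this
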